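/- Let $I$ and $O$ be finite sets, $\Lambda=(\lambda_{ij})_{i,j\in I}$ a rate transition matrix ($\lambda_{ij}\ge 0$ for $i\ne j$, $\sum_j\lambda_{ij}=0$), and $h:I\to O$ a surjection. Let $\Delta$ be the simplex of probability measures on $I$ (row vectors), $\Delta_a$ ($a\in O$) the set of those supported in $h^{-1}(a)$, and $\Delta_e=\bigcup_{a\in O}\Delta_a$. Let $\Omega$ be the set of cadlag functions $\omega:\mathbb R_+\to I$, $X_t(\omega)=\omega(t)$, $\mathcal F^0_t=\sigma(X_s:s\le t)$, $\mathcal F^0=\sigma(X_s:s\ge0)$. For $\mu\in\Delta$ let $P_\mu$ be the (unique) probability measure on $(\Omega,\mathcal F^0)$ making $X$ a Markov process with generator $\Lambda$ and initial distribution $\mu$, i.e. $P_\mu(X_0=i)=\mu(i)$ and $E_\mu[f(X_{t+s})\mid\mathcal F^0_t]=(e^{s\Lambda}f)(X_t)$ $P_\mu$-a.s. for all $t,s\ge 0$ and $f:I\to\mathbb R$. Let $Y_t=h(X_t)$. For $a\in O$ and a row vector $m$ let $H_a[m]=\frac{1}{m1_{h^{-1}(a)}}1_{h^{-1}(a)}*m$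 (where $*$ is the componentwise product) if $m1_{h^{-1}(a)}\neq0$, and $H_a[m]=\nu_a$ otherwise, where $\nu_a\in\Delta_a$ is fixed and arbitrary. For $x\in\Delta_a$ let $t\mapsto\phi_a(t,x)$ be the solution on $[0,\infty)$ of $y'=1_{h^{-1}(a)}*(y\Lambda)-(y\Lambda1_{h^{-1}(a)})\,y$, $y(0)=x$. Let $T_0=0$ and let $T_1<T_2<\cdots$ be the jump times of $Y$ ($T_n=\infty$ if there are fewer than $n$ jumps). The filtering process $\Pi^\mu$ is defined, for every $\omega\in\Omega$, by $\Pi^\mu_0=H_{Y_0}[\mu]$ and, for $n\ge 0$ with $T_n<\infty$, by $\Pi^\mu_t=\phi_{Y_{T_n}}(t-T_n,\Pi^\mu_{T_n})$ for $T_n\le t<T_{n+1}$, and $$\Pi^\mu_{T_{n+1}}=H_{Y_{T_{n+1}}}\big[\phi_{Y_{T_n}}(T_{n+1}-T_n,\Pi^\mu_{T_n})\Lambda\big]\quad\text{if }T_{n+1}<\infty.$$ For $t\ge0$, $\nu\in\Delta_e$ and Borel $A\subseteq\Delta_e$ put $R_t(\nu,A)=P_\nu(\Pi^\nu_t\in A)$.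 Then each $R_t(\nu,\cdot)$ is a probability measure on $\Delta_e$ and, with $R_tf(\nu)=\int_{\Delta_e}f(\rho)\,R_t(\nu,d\rho)$, for every continuous $f:\Delta_e\to\mathbb R$ the function $R_tf$ is continuous on $\Delta_e$ for all $t\ge0$ (Feller property), and $R_tf\to f$ uniformly on $\Delta_e$ as $t\to0$. -/

import Mathlib

open MeasureTheory Filter Topology
open scoped NNReal ENNReal Matrix

namespace NoiseFreeFilter

noncomputable section

/-! ### The effective simplex

Row vectors indexed by the finite state space `I` are functions `I → ℝ`;
the simplex `Δ` of probability measures on `I` is `stdSimplex ℝ I`. -/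

/-- A rate transition matrix (`Q`-matrix): nonnegative off-diagonal entries, zero row sums. -/
structure IsRateMatrix {I : Type*} [Fintype I] (Λ : Matrix I I ℝ) : Prop where
  nonneg : ∀ i j, i ≠ j → 0 ≤ Λ i j
  row_sum : ∀ i, ∑ j, Λ i j = 0

/-- The face `Δ_a` of the probability measures supported in `h⁻¹(a)`. -/
def face {I O : Type*} [Fintype I] (h : I → O) (a : O) : Set (I → ℝ) :=
  {x | x ∈ stdSimplex ℝ I ∧ ∀ i, h i ≠ a → x i = 0}

/-- The effective simplex `Δ_e`, the union of the faces `Δ_a`. -/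
def effSimplex {I O : Type*} [Fintype I] (h : I → O) : Set (I → ℝ) :=
  ⋃ a, face h a

/-- The indicator function of the level set `h⁻¹(a)`. -/
def levelInd {I O : Type*} [DecidableEq O] (h : I → O) (a : O) : I → ℝ :=
  fun i => if h i = a then 1 else 0

/-! ### The flow and the operator `H` -/

/-- The vector field `F_a(y) = 1_{h⁻¹(a)} * (yΛ) - (yΛ 1_{h⁻¹(a)}) y`. -/
def field {I O : Type*} [Fintype I] [DecidableEq O] (Λ : Matrix I I ℝ) (h : I → O) (a : O)
    (y : I → ℝ) : I → ℝ :=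
  levelInd h a * (y ᵥ* Λ) - ((y ᵥ* Λ) ⬝ᵥ levelInd h a) • y

/-- `y` solves `y' = F_a(y)` on `[0, ∞)` with `y 0 = x`. -/
def IsFlowCurve {I O : Type*} [Fintype I] [DecidableEq O] (Λ : Matrix I I ℝ) (h : I → O) (a : O)
    (x : I → ℝ) (y : ℝ → I → ℝ) : Prop :=
  y 0 = x ∧ ∀ t : ℝ, 0 ≤ t → HasDerivWithinAt y (field Λ h a (y t)) (Set.Ici 0) t

open Classical in
/-- The flow `φ_a(t, x)`: the value at time `t` of the solution of `y' = F_a(y)` started at `x`.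
The solution is unique, and it exists globally when `x ∈ Δ_a`; the other starting points play
no role. -/
def flow {I O : Type*} [Fintype I] [DecidableEq O] (Λ : Matrix I I ℝ) (h : I → O) (a : O)
    (t : ℝ≥0) (x : I → ℝ) : I → ℝ :=
  if hy : ∃ y : ℝ → I → ℝ, IsFlowCurve Λ h a x y then hy.choose t else x

/-- The operator `H_a`: restriction to `h⁻¹(a)` followed by normalization, with the fixed
probability `κ a` as value when the mass of `h⁻¹(a)` is zero. -/
def condOp {I O : Type*} [Fintype I] [DecidableEq O] (h : I → O) (κ : O → I → ℝ) (a : O)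
    (m : I → ℝ) : I → ℝ :=
  if m ⬝ᵥ levelInd h a ≠ 0 then (m ⬝ᵥ levelInd h a)⁻¹ • (levelInd h a * m) else κ a

/-! ### The canonical path space and the law of the Markov chain -/

/-- The space of cadlag functions `[0, ∞) → I`. As `I` is finite and carries the discrete
topology, right continuity and existence of left limits mean that `ω` is constant on
`[t, t + ε)` and on `(t - ε, t)` for small `ε`. -/
def PathSpace (I : Type*) : Type _ :=
  {ω : ℝ≥0 → I // (∀ t, ∀ᶠ s in 𝓝[≥] t, ω s = ω t) ∧
    ∀ t, 0 < t → ∃ i, ∀ᶠ s in 𝓝[<] t, ω s = i}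

/-- The coordinate process `X_t(ω) = ω(t)`. -/
def coord {I : Type*} (t : ℝ≥0) (ω : PathSpace I) : I := ω.1 t

/-- The `σ`-algebra generated by all the coordinates, `I` carrying the discrete one. -/
instance {I : Type*} : MeasurableSpace (PathSpace I) :=
  ⨆ t : ℝ≥0, MeasurableSpace.comap (coord t) ⊤

/-- The natural filtration `σ(X_s : s ≤ t)`. -/
@[reducible] def natFilt (I : Type*) (t : ℝ≥0) : MeasurableSpace (PathSpace I) :=
  ⨆ s : ℝ≥0, ⨆ _ : s ≤ t, MeasurableSpace.comap (coord s) ⊤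

/-- `P` is a probability measure on path space that makes the coordinate process a Markov process
with generator `Λ` and initial distribution `μ`. -/
structure IsMarkovLaw {I : Type*} [Fintype I] [DecidableEq I] (Λ : Matrix I I ℝ) (μ : I → ℝ)
    (P : Measure (PathSpace I)) : Prop where
  prob : IsProbabilityMeasure P
  init : ∀ i, P {ω | coord 0 ω = i} = ENNReal.ofReal (μ i)
  markov : ∀ (t s : ℝ≥0) (f : I → ℝ),
    P[fun ω => f (coord (t + s) ω) | natFilt I t]
      =ᵐ[P] fun ω => (NormedSpace.exp ((s : ℝ) • Λ) *ᵥ f) (coord t ω)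

/-! ### The filtering process -/

/-- The observed trajectory `Y_t(ω) = h(X_t(ω))`. -/
def obs {I O : Type*} (h : I → O) (ω : PathSpace I) (t : ℝ≥0) : O := h (coord t ω)

/-- The jump times of a piecewise constant trajectory `y`: `T_0 = 0`, and `T_{n+1}` is the first
time after `T_n` at which `y` leaves the value `y(T_n)`; it is `∞` if there is no such time. -/
def jumpTime {O : Type*} (y : ℝ≥0 → O) : ℕ → ℝ≥0∞
  | 0 => 0
  | n + 1 => sInf ((fun t : ℝ≥0 => (t : ℝ≥0∞)) ''
      {t | jumpTime y n ≤ t ∧ y t ≠ y (jumpTime y n).toNNReal})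

/-- The values `Π_{T_n}` of the filtering process at the jump times of `y`:
`Π_0 = H_{y(0)}[μ]` and `Π_{T_{n+1}} = H_{y(T_{n+1})}[φ(T_{n+1} - T_n, Π_{T_n}) Λ]`
(meaningful for those `n` with `T_n < ∞`). -/
def filterAtJump {I O : Type*} [Fintype I] [DecidableEq O] (Λ : Matrix I I ℝ) (h : I → O)
    (κ : O → I → ℝ) (μ : I → ℝ) (y : ℝ≥0 → O) : ℕ → I → ℝ
  | 0 => condOp h κ (y 0) μ
  | n + 1 => condOp h κ (y (jumpTime y (n + 1)).toNNReal)
      (flow Λ h (y (jumpTime y n).toNNReal)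
        ((jumpTime y (n + 1)).toNNReal - (jumpTime y n).toNNReal)
        (filterAtJump Λ h κ μ y n) ᵥ* Λ)

/-- The index of the last jump up to time `t`, that is, the `n` with `T_n ≤ t < T_{n+1}`. -/
def lastJump {O : Type*} (y : ℝ≥0 → O) (t : ℝ≥0) : ℕ := sSup {n : ℕ | jumpTime y n ≤ t}

/-- The filtering process `Π^μ_t(ω)`: it equals `φ(t - T_n, Π_{T_n})` for `T_n ≤ t < T_{n+1}`,
where `T_n` are the jump times of the observed trajectory. -/
def filterProc {I O : Type*} [Fintype I] [DecidableEq O] (Λ : Matrix I I ℝ) (h : I → O)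
    (κ : O → I → ℝ) (μ : I → ℝ) (t : ℝ≥0) (ω : PathSpace I) : I → ℝ :=
  let y := obs h ω
  let n := lastJump y t
  flow Λ h (y (jumpTime y n).toNNReal) (t - (jumpTime y n).toNNReal) (filterAtJump Λ h κ μ y n)

/-- The transition function `R_t(ν, A) = P_ν(Π^ν_t ∈ A)`, for `ν ∈ Δ_e` and Borel `A ⊆ Δ_e`. -/
def transition {I O : Type*} [Fintype I] [DecidableEq O] (Λ : Matrix I I ℝ) (h : I → O)
    (κ : O → I → ℝ) (P : (I → ℝ) → Measure (PathSpace I)) (t : ℝ≥0) (ν : effSimplex h) :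
    Measure (effSimplex h) :=
  ((P ν).map (filterProc Λ h κ ν t)).comap Subtype.val

end

end NoiseFreeFilter

open NoiseFreeFilter

/-! The proof replaces the filter by its discrete-time counterpart. On the grid `0, δ, …, Nδ` the
matrix product `μ 1_{y₀} e^{δΛ} 1_{y₁} ⋯ e^{δΛ} 1_{y_N}` lists the joint probabilities of the observed
pattern `y` and the final state (`IsMarkovLaw.measureReal_gridObs_coord`); its normalization
`gridFilter` is the conditional law of `X_{Nδ}` given the observations on the grid. The expectation
of `F(gridFilter)` is a finite sum of terms `p F(ρ / p)` with `ρ` linear in the initial distribution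
and `p` the mass of `ρ`. Such a term is continuous even where `p = 0`, since `F` is bounded; this is
why the arbitrary choice of `H_a` on vectors of zero mass does no harm
(`continuous_sum_mul_normalize`).

The filter itself is, path by path, the normalization of the image of `μ` under a similar product:
the flow is a normalized linear flow (`flow_eq`), and at a jump of the observation to `b` the
unnormalized filter is multiplied by `Λ1_b` (`exists_filterProc_vecMul_of_const`,
`exists_filterProc_vecMul_of_jump`). On a cell of length `δ` with at most one jump of the chain the
two one-cell matrices differ by `O(δ²)`, once the matrix of a cell with a jump of the observation
is multiplied by `δ` (`exists_cell_matrix`). If `e(y)` denotes the accumulated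
error and `p(y)` the probability of the pattern `y`, the two normalized vectors are at distance at
most `2 e(y) / p(y)` when `y` is observed, so that the expectation of the distance is at most
`2 ∑ e(y)`. The weights, `1 + O(δ)` for a cell with equal observations at its endpoints and `O(δ)` for the
others, keep `∑ e(y)` of order `1 / N` (`sum_gridErr_le`). Two jumps in some cell have probability
of order `1 / N` as well (`IsMarkovLaw.measure_not_atMostOneJump_le`).

All these bounds are uniform in `μ` (`measure_le_dist_gridFilter_le`). Hence the filter is a limit
in probability of measurable functions, which gives its measurability, and its expectations are
uniform limits of continuous functions of `μ`, which is the Feller property. A single short cell,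
in which the chain most likely does not jump, gives the behaviour as `t → 0`
(`measure_lt_dist_filterProc_le`). -/

namespace NoiseFreeFilter

open scoped Matrix.Norms.Operator

/-! ### Matrix exponentials -/

section MatrixExp

/-- Second-order Taylor bound for the exponential, uniform on a neighbourhood of `0`. -/
lemma exists_norm_exp_sub_le (𝔸 : Type*) [NormedRing 𝔸] [NormedAlgebra ℝ 𝔸] [CompleteSpace 𝔸] :
    ∃ C > 0, ∃ r > 0, ∀ B : 𝔸, ‖B‖ ≤ r →
      ‖NormedSpace.exp B - 1‖ ≤ C * ‖B‖ ∧ ‖NormedSpace.exp B - 1 - B‖ ≤ C * ‖B‖ ^ 2 := by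
  have h0 := NormedSpace.exp_hasFPowerSeriesAt_zero (𝕂 := ℝ) (𝔸 := 𝔸)
  obtain ⟨C, hC, hb⟩ := (h0.isBigO_sub_partialSum_pow 2).exists_pos
  obtain ⟨r, hr, hball⟩ := Metric.eventually_nhds_iff.1 hb.bound
  refine ⟨C + 1, by positivity, min (r / 2) (1 / (C + 1)), by positivity, fun B hB => ?_⟩
  have h2 := hball (y := B) (by
    rw [dist_zero_right]
    exact lt_of_le_of_lt (hB.trans (min_le_left _ _)) (by linarith))
  have hps : (NormedSpace.expSeries ℝ 𝔸).partialSum 2 B = 1 + B := by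
    simp [FormalMultilinearSeries.partialSum, Finset.sum_range_succ,
      NormedSpace.expSeries_apply_eq]
  rw [hps, zero_add, norm_pow, norm_norm, ← sub_sub] at h2
  have h3 : ‖NormedSpace.exp B - 1 - B‖ ≤ (C + 1) * ‖B‖ ^ 2 :=
    h2.trans (mul_le_mul_of_nonneg_right (by linarith) (by positivity))
  refine ⟨?_, h3⟩
  have h4 : C * ‖B‖ ≤ C := by
    have : ‖B‖ ≤ 1 := (hB.trans (min_le_right _ _)).trans (by
      rw [div_le_one (by positivity)]; linarith)
    exact mul_le_of_le_one_right hC.le this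
  calc ‖NormedSpace.exp B - 1‖ = ‖(NormedSpace.exp B - 1 - B) + B‖ := by rw [sub_add_cancel]
    _ ≤ C * ‖B‖ ^ 2 + ‖B‖ := (norm_add_le _ _).trans (by gcongr)
    _ = (C * ‖B‖ + 1) * ‖B‖ := by ring
    _ ≤ (C + 1) * ‖B‖ := by gcongr

variable {I : Type*} [Fintype I] [DecidableEq I]

lemma one_le_exp_of_nonneg {B : Matrix I I ℝ} (hB : ∀ i j, 0 ≤ B i j) (i j : I) :
    (1 : Matrix I I ℝ) i j ≤ NormedSpace.exp B i j := by
  have hpow : ∀ n i j, 0 ≤ (B ^ n) i j := by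
    intro n
    induction n with
    | zero => intro i j; rw [pow_zero, Matrix.one_apply]; split_ifs <;> norm_num
    | succ n ih =>
      intro i j
      rw [pow_succ, Matrix.mul_apply]
      exact Finset.sum_nonneg fun k _ => mul_nonneg (ih i k) (hB k j)
  have hs := NormedSpace.exp_series_hasSum_exp' (𝕂 := ℝ) B
  have hs' := Pi.hasSum.1 (Pi.hasSum.1 hs i) j
  have := le_hasSum hs' 0 fun n _ => by
    exact mul_nonneg (by positivity) (hpow n i j)
  simp only [Nat.factorial_zero, Nat.cast_one, inv_one, pow_zero, one_smul] at this
  exact this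

/-- The exponential of a matrix with nonnegative off-diagonal entries dominates a positive
multiple of the identity: add a multiple of the identity to make all entries nonnegative. -/
lemma exists_smul_one_le_exp {M : Matrix I I ℝ} (hM : ∀ i j, i ≠ j → 0 ≤ M i j) {t : ℝ}
    (ht : 0 ≤ t) : ∃ r > 0, ∀ i j, r * (1 : Matrix I I ℝ) i j ≤ NormedSpace.exp (t • M) i j := by
  set c : ℝ := ∑ i, |M i i|
  have hc : ∀ i, 0 ≤ M i i + c := fun i => by
    have := Finset.single_le_sum (f := fun i => |M i i|) (fun i _ => abs_nonneg _)
      (Finset.mem_univ i)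
    have h2 := neg_abs_le (M i i)
    simp only [c] at *
    linarith
  have hB : ∀ i j, 0 ≤ (t • (M + c • (1 : Matrix I I ℝ))) i j := by
    intro i j
    simp only [Matrix.smul_apply, Matrix.add_apply, smul_eq_mul, Matrix.one_apply]
    refine mul_nonneg ht ?_
    by_cases hij : i = j
    · subst hij; simpa using hc i
    · simpa [hij] using hM i j hij
  have hsplit : t • M = t • (M + c • (1 : Matrix I I ℝ)) + algebraMap ℝ _ (-(t * c)) := by
    rw [Algebra.algebraMap_eq_smul_one, smul_add, smul_smul, neg_smul, add_neg_cancel_right]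
  have hexp : NormedSpace.exp (t • M)
      = Real.exp (-(t * c)) • NormedSpace.exp (t • (M + c • (1 : Matrix I I ℝ))) := by
    have hscal : NormedSpace.exp (algebraMap ℝ (Matrix I I ℝ) (-(t * c)))
        = algebraMap ℝ _ (NormedSpace.exp (-(t * c))) :=
      (NormedSpace.algebraMap_exp_comm _).symm
    rw [hsplit, Matrix.exp_add_of_commute _ _ (Algebra.commute_algebraMap_right _ _),
      hscal, ← Real.exp_eq_exp_ℝ, Algebra.algebraMap_eq_smul_one,
      mul_smul_comm, mul_one]
  refine ⟨Real.exp (-(t * c)), Real.exp_pos _, fun i j => ?_⟩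
  rw [hexp, Matrix.smul_apply, smul_eq_mul]
  exact mul_le_mul_of_nonneg_left (one_le_exp_of_nonneg hB i j) (Real.exp_pos _).le

lemma exp_nonneg_of_offDiag_nonneg {M : Matrix I I ℝ} (hM : ∀ i j, i ≠ j → 0 ≤ M i j) {t : ℝ}
    (ht : 0 ≤ t) (i j : I) : 0 ≤ NormedSpace.exp (t • M) i j := by
  obtain ⟨r, hr, h⟩ := exists_smul_one_le_exp hM ht
  refine le_trans (mul_nonneg hr.le ?_) (h i j)
  rw [Matrix.one_apply]; split_ifs <;> norm_num

lemma exp_smul_mul_of_mul_eq_zero {M N : Matrix I I ℝ} (hMN : M * N = 0) (t : ℝ) :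
    NormedSpace.exp (t • M) * N = N := by
  have hd : ∀ u : ℝ, HasDerivAt (fun u : ℝ => NormedSpace.exp (u • M) * N) 0 u := fun u => by
    have := (hasDerivAt_exp_smul_const (𝕂 := ℝ) M u).mul_const N
    rwa [mul_assoc, hMN, mul_zero] at this
  have := is_const_of_deriv_eq_zero (fun u => (hd u).differentiableAt) (fun u => (hd u).deriv) t 0
  simpa using this

lemma exp_add_smul (M : Matrix I I ℝ) (s t : ℝ) :
    NormedSpace.exp ((s + t) • M) = NormedSpace.exp (s • M) * NormedSpace.exp (t • M) := by
  rw [add_smul, Matrix.exp_add_of_commute]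
  exact ((Commute.refl M).smul_left s).smul_right t

end MatrixExp

/-! ### Conditioning on a level set -/

section Conditioning

variable {I O : Type*} [Fintype I] [DecidableEq O]

lemma condOp_mem_face {h : I → O} {κ : O → I → ℝ} (hκ : ∀ a, κ a ∈ face h a) {a : O} {m : I → ℝ}
    (hm : ∀ i, h i = a → 0 ≤ m i) : condOp h κ a m ∈ face h a := by
  have hnn : ∀ i, 0 ≤ levelInd h a i * m i := fun i => by
    simp only [levelInd]; split_ifs with hi
    · simpa using hm i hi
    · simp
  rw [condOp]
  split_ifs with h0
  · have hpos : 0 ≤ m ⬝ᵥ levelInd h a := Finset.sum_nonneg fun i _ => by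
      rw [mul_comm]; exact hnn i
    refine ⟨⟨fun i => mul_nonneg (inv_nonneg.2 hpos) (hnn i), ?_⟩, fun i hi => ?_⟩
    · simp only [Pi.smul_apply, Pi.mul_apply, smul_eq_mul, ← Finset.mul_sum]
      rw [← inv_mul_cancel₀ h0]
      simp [dotProduct, mul_comm]
    · simp [levelInd, hi]
  · exact hκ a

lemma vecMul_nonneg_of_ne {Λ : Matrix I I ℝ} (hΛ : IsRateMatrix Λ) {h : I → O} {a b : O}
    (hab : b ≠ a) {x : I → ℝ} (hx : x ∈ face h a) (j : I) (hj : h j = b) : 0 ≤ (x ᵥ* Λ) j := by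
  refine Finset.sum_nonneg fun i _ => ?_
  by_cases hi : h i = a
  · refine mul_nonneg (hx.1.1 i) (hΛ.nonneg i j ?_)
    rintro rfl
    exact hab (hj.symm.trans hi)
  · simp [hx.2 i hi]

end Conditioning

/-! ### The flow as a normalized linear flow -/

section Flow

variable {I O : Type*} [Fintype I] [DecidableEq I] [DecidableEq O]

/-- The projection onto the coordinates in `h⁻¹(a)`, as a diagonal matrix. -/
def levelProj (h : I → O) (a : O) : Matrix I I ℝ := Matrix.diagonal (levelInd h a)

/-- The semigroup `e^{tΛ1_a}`. On row vectors supported in `h⁻¹(a)` it solves the linear equation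
`u' = 1_{h⁻¹(a)} * (uΛ)`, whose normalization is the flow `φ_a`. -/
noncomputable def killedExp (Λ : Matrix I I ℝ) (h : I → O) (a : O) (t : ℝ) : Matrix I I ℝ :=
  NormedSpace.exp (t • (Λ * levelProj h a))

lemma vecMul_levelProj (h : I → O) (a : O) (x : I → ℝ) :
    x ᵥ* levelProj h a = levelInd h a * x := by
  ext i
  simp [levelProj, Matrix.vecMul_diagonal, mul_comm]

lemma vecMul_levelProj_of_mem_face {h : I → O} {a : O} {x : I → ℝ} (hx : x ∈ face h a) :
    x ᵥ* levelProj h a = x := by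
  rw [vecMul_levelProj]
  ext i
  by_cases hi : h i = a
  · simp [levelInd, hi]
  · simp [levelInd, hi, hx.2 i hi]

lemma levelProj_mul_self (h : I → O) (a : O) : levelProj h a * levelProj h a = levelProj h a := by
  rw [levelProj, Matrix.diagonal_mul_diagonal]
  congr 1
  ext i
  simp [levelInd]

lemma levelProj_mul_of_ne (h : I → O) {a b : O} (hab : a ≠ b) :
    levelProj h a * levelProj h b = 0 := by
  rw [levelProj, levelProj, Matrix.diagonal_mul_diagonal, Matrix.diagonal_eq_zero]
  ext i
  simp only [levelInd, Pi.zero_apply]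
  split_ifs with h1 h2
  · exact absurd (h1.symm.trans h2) hab
  all_goals simp

lemma norm_levelProj_le (h : I → O) (a : O) : ‖levelProj h a‖ ≤ 1 := by
  rw [levelProj, Matrix.linfty_opNorm_diagonal, pi_norm_le_iff_of_nonneg zero_le_one]
  intro i
  simp only [levelInd]
  split_ifs <;> simp

lemma offDiag_nonneg_mul_levelProj {Λ : Matrix I I ℝ} (hΛ : IsRateMatrix Λ) (h : I → O) (a : O)
    (i j : I) (hij : i ≠ j) : 0 ≤ (Λ * levelProj h a) i j := by
  rw [levelProj, Matrix.mul_diagonal]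
  refine mul_nonneg (hΛ.nonneg i j hij) ?_
  simp only [levelInd]
  split_ifs <;> norm_num

lemma killedExp_add (Λ : Matrix I I ℝ) (h : I → O) (a : O) (s t : ℝ) :
    killedExp Λ h a (s + t) = killedExp Λ h a s * killedExp Λ h a t := exp_add_smul _ s t

lemma killedExp_zero (Λ : Matrix I I ℝ) (h : I → O) (a : O) : killedExp Λ h a 0 = 1 := by
  simp [killedExp]

lemma vecMul_killedExp_apply_of_ne {Λ : Matrix I I ℝ} {h : I → O} {a : O} {x : I → ℝ}
    (hx : x ∈ face h a) (t : ℝ) {j : I} (hj : h j ≠ a) : (x ᵥ* killedExp Λ h a t) j = 0 := by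
  have h0 : (Λ * levelProj h a) * (1 - levelProj h a) = 0 := by
    rw [mul_assoc, mul_sub, mul_one, levelProj_mul_self, sub_self, mul_zero]
  have h1 := exp_smul_mul_of_mul_eq_zero h0 t
  have h2 : (x ᵥ* killedExp Λ h a t) ᵥ* (1 - levelProj h a) = 0 := by
    rw [Matrix.vecMul_vecMul, killedExp, h1, Matrix.vecMul_sub, Matrix.vecMul_one,
      vecMul_levelProj_of_mem_face hx, sub_self]
  have h3 := congrFun h2 j
  rw [Matrix.vecMul_sub, Matrix.vecMul_one, vecMul_levelProj] at h3
  simpa [levelInd, hj] using h3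

lemma vecMul_killedExp_nonneg {Λ : Matrix I I ℝ} (hΛ : IsRateMatrix Λ) {h : I → O} {a : O}
    {x : I → ℝ} (hx : x ∈ face h a) {t : ℝ} (ht : 0 ≤ t) (j : I) :
    0 ≤ (x ᵥ* killedExp Λ h a t) j :=
  Finset.sum_nonneg fun i _ => mul_nonneg (hx.1.1 i)
    (exp_nonneg_of_offDiag_nonneg (offDiag_nonneg_mul_levelProj hΛ h a) ht i j)

lemma sum_vecMul_killedExp_pos {Λ : Matrix I I ℝ} (hΛ : IsRateMatrix Λ) {h : I → O} {a : O}
    {x : I → ℝ} (hx : x ∈ face h a) {t : ℝ} (ht : 0 ≤ t) :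
    0 < ∑ j, (x ᵥ* killedExp Λ h a t) j := by
  obtain ⟨r, hr, hle⟩ := exists_smul_one_le_exp (offDiag_nonneg_mul_levelProj hΛ h a) ht
  calc (0 : ℝ) < r := hr
    _ = ∑ j, ∑ i, x i * (r * (1 : Matrix I I ℝ) i j) := by
      rw [Finset.sum_comm]
      simp_rw [← Finset.mul_sum]
      simp [Matrix.one_apply, ← Finset.sum_mul, hx.1.2]
    _ ≤ ∑ j, (x ᵥ* killedExp Λ h a t) j :=
      Finset.sum_le_sum fun j _ => Finset.sum_le_sum fun i _ =>
        mul_le_mul_of_nonneg_left (hle i j) (hx.1.1 i)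

lemma field_eq (Λ : Matrix I I ℝ) (h : I → O) (a : O) (y : I → ℝ) :
    field Λ h a y = y ᵥ* (Λ * levelProj h a) - (∑ j, (y ᵥ* (Λ * levelProj h a)) j) • y := by
  rw [field, ← Matrix.vecMul_vecMul, vecMul_levelProj]
  congr 2
  simp [dotProduct, mul_comm]

lemma hasDerivAt_vecMul_killedExp (Λ : Matrix I I ℝ) (h : I → O) (a : O) (x : I → ℝ) (t : ℝ) :
    HasDerivAt (fun t => x ᵥ* killedExp Λ h a t)
      ((x ᵥ* killedExp Λ h a t) ᵥ* (Λ * levelProj h a)) t := by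
  let L : Matrix I I ℝ →ₗ[ℝ] (I → ℝ) :=
    { toFun := fun A => x ᵥ* A
      map_add' := fun A B => Matrix.vecMul_add A B x
      map_smul' := fun c A => Matrix.vecMul_smul _ _ _ }
  have h1 := hasDerivAt_exp_smul_const (𝕂 := ℝ) (Λ * levelProj h a) t
  have h2 := (LinearMap.toContinuousLinearMap L).hasFDerivAt.comp_hasDerivAt t h1
  rw [Matrix.vecMul_vecMul]
  exact h2

lemma isFlowCurve_normalized {Λ : Matrix I I ℝ} (hΛ : IsRateMatrix Λ) {h : I → O} {a : O}
    {x : I → ℝ} (hx : x ∈ face h a) :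
    IsFlowCurve Λ h a x
      fun t => (∑ j, (x ᵥ* killedExp Λ h a t) j)⁻¹ • (x ᵥ* killedExp Λ h a t) := by
  refine ⟨by simp [killedExp_zero, hx.1.2], fun t ht => HasDerivAt.hasDerivWithinAt ?_⟩
  have hU := hasDerivAt_vecMul_killedExp Λ h a x t
  have hs : HasDerivAt (fun t => ∑ j, (x ᵥ* killedExp Λ h a t) j)
      (∑ j, ((x ᵥ* killedExp Λ h a t) ᵥ* (Λ * levelProj h a)) j) t :=
    HasDerivAt.fun_sum fun j _ => hasDerivAt_pi.1 hU j
  have hne := (sum_vecMul_killedExp_pos hΛ hx ht).ne'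
  have hd : HasDerivAt (fun t => (∑ j, (x ᵥ* killedExp Λ h a t) j)⁻¹ • (x ᵥ* killedExp Λ h a t))
    _ t := (hs.fun_inv hne).smul hU
  refine hd.congr_deriv ?_
  rw [field_eq, Matrix.smul_vecMul]
  simp only [Pi.smul_apply, smul_eq_mul, ← Finset.mul_sum, smul_smul]
  rw [sub_eq_add_neg, ← neg_smul]
  congr 2
  field_simp

lemma IsFlowCurve.eqOn {Λ : Matrix I I ℝ} {h : I → O} {a : O} {x : I → ℝ} {y z : ℝ → I → ℝ}
    (hy : IsFlowCurve Λ h a x y) (hz : IsFlowCurve Λ h a x z) {t : ℝ} (ht : 0 ≤ t) :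
    y t = z t := by
  have hC1 : ContDiff ℝ 1 (field Λ h a) := by
    have : field Λ h a = fun y => y ᵥ* (Λ * levelProj h a)
        - (∑ j, (y ᵥ* (Λ * levelProj h a)) j) • y := funext (field_eq Λ h a)
    rw [this]
    have h1 : ContDiff ℝ 1 fun y : I → ℝ => y ᵥ* (Λ * levelProj h a) := by
      refine contDiff_pi.2 fun j => ?_
      simp only [Matrix.vecMul, dotProduct]
      fun_prop
    exact h1.sub (ContDiff.smul (ContDiff.sum fun j _ => contDiff_pi.1 h1 j) contDiff_id)
  have hcont : ∀ w, IsFlowCurve Λ h a x w → ContinuousOn w (Set.Icc 0 t) := fun w hw u hu =>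
    ((hw.2 u hu.1).continuousWithinAt).mono Set.Icc_subset_Ici_self
  have hder : ∀ w, IsFlowCurve Λ h a x w → ∀ u ∈ Set.Ico 0 t,
      HasDerivWithinAt w (field Λ h a (w u)) (Set.Ici u) u := fun w hw u hu =>
    (hw.2 u hu.1).mono (Set.Ici_subset_Ici.2 hu.1)
  have hcpt : IsCompact (y '' Set.Icc 0 t ∪ z '' Set.Icc 0 t) :=
    (isCompact_Icc.image_of_continuousOn (hcont y hy)).union
      (isCompact_Icc.image_of_continuousOn (hcont z hz))
  obtain ⟨K, hK⟩ := (hC1.locallyLipschitz.locallyLipschitzOn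
    (s := y '' Set.Icc 0 t ∪ z '' Set.Icc 0 t)).exists_lipschitzOnWith_of_compact hcpt
  exact ODE_solution_unique_of_mem_Icc_right (v := fun _ => field Λ h a)
    (s := fun _ => y '' Set.Icc 0 t ∪ z '' Set.Icc 0 t) (fun _ _ => hK) (hcont y hy) (hder y hy)
    (fun u hu => Or.inl ⟨u, Set.Ico_subset_Icc_self hu, rfl⟩) (hcont z hz) (hder z hz)
    (fun u hu => Or.inr ⟨u, Set.Ico_subset_Icc_self hu, rfl⟩) (hy.1.trans hz.1.symm)
    ⟨ht, le_rfl⟩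

lemma flow_eq {Λ : Matrix I I ℝ} (hΛ : IsRateMatrix Λ) {h : I → O} {a : O} {x : I → ℝ}
    (hx : x ∈ face h a) (t : ℝ≥0) :
    flow Λ h a t x = (∑ j, (x ᵥ* killedExp Λ h a t) j)⁻¹ • (x ᵥ* killedExp Λ h a t) := by
  have hc := isFlowCurve_normalized hΛ hx
  have hex : ∃ y : ℝ → I → ℝ, IsFlowCurve Λ h a x y := ⟨_, hc⟩
  rw [flow, dif_pos hex]
  exact hex.choose_spec.eqOn hc t.2

lemma flow_mem_face {Λ : Matrix I I ℝ} (hΛ : IsRateMatrix Λ) {h : I → O} {a : O} {x : I → ℝ}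
    (hx : x ∈ face h a) (t : ℝ≥0) : flow Λ h a t x ∈ face h a := by
  have hpos := sum_vecMul_killedExp_pos hΛ hx t.coe_nonneg
  rw [flow_eq hΛ hx]
  refine ⟨⟨fun j => mul_nonneg (inv_nonneg.2 hpos.le) (vecMul_killedExp_nonneg hΛ hx t.coe_nonneg j), ?_⟩,
    fun j hj => ?_⟩
  · simp only [Pi.smul_apply, smul_eq_mul, ← Finset.mul_sum]
    exact inv_mul_cancel₀ hpos.ne'
  · rw [Pi.smul_apply, vecMul_killedExp_apply_of_ne hx _ hj, smul_zero]

lemma exists_vecMul_killedExp_eq {Λ : Matrix I I ℝ} (hΛ : IsRateMatrix Λ) {h : I → O} {a : O}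
    {x : I → ℝ} (hx : x ∈ face h a) (t : ℝ≥0) :
    ∃ c > (0 : ℝ), x ᵥ* killedExp Λ h a t = c • flow Λ h a t x := by
  have hpos := sum_vecMul_killedExp_pos hΛ hx t.coe_nonneg
  refine ⟨∑ j, (x ᵥ* killedExp Λ h a t) j, hpos, ?_⟩
  rw [flow_eq hΛ hx, smul_smul, mul_inv_cancel₀ hpos.ne', one_smul]

lemma exists_flow_vecMul_killedExp_eq {Λ : Matrix I I ℝ} (hΛ : IsRateMatrix Λ) {h : I → O}
    {a : O} {x : I → ℝ} (hx : x ∈ face h a) (s t : ℝ≥0) :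
    ∃ c > (0 : ℝ), flow Λ h a s x ᵥ* killedExp Λ h a (t - s) = c • flow Λ h a t x := by
  obtain ⟨c, hc, h1⟩ := exists_vecMul_killedExp_eq hΛ hx s
  obtain ⟨d, hd, h2⟩ := exists_vecMul_killedExp_eq hΛ hx t
  refine ⟨c⁻¹ * d, by positivity, ?_⟩
  rw [mul_smul, ← h2, ← add_sub_cancel (s : ℝ) t, killedExp_add, ← Matrix.vecMul_vecMul, h1,
    Matrix.smul_vecMul, smul_smul, inv_mul_cancel₀ hc.ne', one_smul, add_sub_cancel]

/-- For `m` nonnegative on `h⁻¹(a)`, restricting `m` to `h⁻¹(a)` gives a nonnegative multiple of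
`H_a[m]`; when the mass of `h⁻¹(a)` is zero the restriction vanishes and the multiple is `0`. -/
lemma exists_vecMul_levelProj_eq {h : I → O} {κ : O → I → ℝ} {a : O} {m : I → ℝ}
    (hm : ∀ i, h i = a → 0 ≤ m i) : ∃ c ≥ (0 : ℝ), m ᵥ* levelProj h a = c • condOp h κ a m := by
  have hnn : ∀ i, 0 ≤ m i * levelInd h a i := fun i => by
    simp only [levelInd]; split_ifs with hi
    · simpa using hm i hi
    · simp
  refine ⟨m ⬝ᵥ levelInd h a, Finset.sum_nonneg fun i _ => hnn i, ?_⟩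
  rw [vecMul_levelProj, condOp]
  split_ifs with h0
  · rw [smul_smul, mul_inv_cancel₀ h0, one_smul]
  · rw [not_not] at h0
    rw [h0, zero_smul]
    ext i
    have := (Finset.sum_eq_zero_iff_of_nonneg fun i _ => hnn i).1 h0 i (Finset.mem_univ i)
    rw [Pi.mul_apply, mul_comm, this, Pi.zero_apply]

end Flow

/-! ### Jump times of a piecewise constant trajectory -/

section JumpTime

variable {O : Type*} {y : ℝ≥0 → O}

lemma jumpTime_le_succ (y : ℝ≥0 → O) (n : ℕ) : jumpTime y n ≤ jumpTime y (n + 1) := by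
  rw [jumpTime]
  refine le_sInf ?_
  rintro _ ⟨t, ht, rfl⟩
  exact ht.1

lemma jumpTime_mono (y : ℝ≥0 → O) : Monotone (jumpTime y) :=
  monotone_nat_of_le_succ (jumpTime_le_succ y)

lemma eq_of_lt_jumpTime_succ {n : ℕ} {t : ℝ≥0} (h1 : jumpTime y n ≤ t)
    (h2 : t < jumpTime y (n + 1)) : y t = y (jumpTime y n).toNNReal := by
  by_contra hne
  rw [jumpTime] at h2
  exact absurd h2 (not_lt.2 (sInf_le ⟨t, ⟨h1, hne⟩, rfl⟩))

lemma ne_of_jumpTime_succ_eq (hr : ∀ t, ∀ᶠ s in 𝓝[≥] t, y s = y t) {n : ℕ} {r : ℝ≥0}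
    (h : jumpTime y (n + 1) = r) : y r ≠ y (jumpTime y n).toNNReal := by
  intro heq
  obtain ⟨u, hu, hsub⟩ := mem_nhdsGE_iff_exists_Ico_subset.1 (hr r)
  have hru : (r : ℝ≥0∞) < u := by exact_mod_cast hu
  have : (u : ℝ≥0∞) ≤ jumpTime y (n + 1) := by
    rw [jumpTime]
    refine le_sInf ?_
    rintro _ ⟨t, ht, rfl⟩
    have hrt : r ≤ t := by
      have : jumpTime y (n + 1) ≤ t := by
        rw [jumpTime]; exact sInf_le ⟨t, ht, rfl⟩
      rw [h] at this
      exact_mod_cast this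
    by_contra htu
    have htu' : t < u := by
      exact ENNReal.coe_lt_coe.1 (not_le.1 htu)
    exact ht.2 ((hsub ⟨hrt, htu'⟩ : y t = y r).trans heq)
  rw [h] at this
  exact absurd hru (not_lt.2 this)

lemma jumpTime_lt_succ (hr : ∀ t, ∀ᶠ s in 𝓝[≥] t, y s = y t) {n : ℕ} {r : ℝ≥0}
    (h : jumpTime y (n + 1) = r) : jumpTime y n < jumpTime y (n + 1) := by
  refine lt_of_le_of_ne (jumpTime_le_succ y n) fun heq => ne_of_jumpTime_succ_eq hr h ?_
  rw [heq, h, ENNReal.toNNReal_coe]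

/-- Only finitely many jumps occur before a finite time: otherwise the jump times accumulate at a
point where `y` has no left limit. -/
lemma exists_lt_jumpTime (hr : ∀ t, ∀ᶠ s in 𝓝[≥] t, y s = y t)
    (hl : ∀ t, 0 < t → ∃ i, ∀ᶠ s in 𝓝[<] t, y s = i) (t : ℝ≥0) : ∃ n, t < jumpTime y n := by
  by_contra! hle
  set τ : ℕ → ℝ≥0 := fun n => (jumpTime y n).toNNReal
  have hτ : ∀ n, jumpTime y n = τ n := fun n =>
    (ENNReal.coe_toNNReal (ne_top_of_le_ne_top ENNReal.coe_ne_top (hle n))).symm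
  have hτt : ∀ n, τ n ≤ t := fun n => by
    have := hle n
    rw [hτ] at this
    exact_mod_cast this
  have hlt : ∀ n, τ n < τ (n + 1) := fun n => by
    have := jumpTime_lt_succ hr (hτ (n + 1))
    rw [hτ, hτ] at this
    exact_mod_cast this
  have hmono : StrictMono τ := strictMono_nat_of_lt_succ hlt
  have hbdd : BddAbove (Set.range τ) := ⟨t, by rintro _ ⟨n, rfl⟩; exact hτt n⟩
  set σ := ⨆ n, τ n
  have hσ : ∀ n, τ n < σ := fun n => (hlt n).trans_le (le_ciSup hbdd (n + 1))
  have htend : Tendsto τ atTop (𝓝[<] σ) :=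
    tendsto_nhdsWithin_iff.2 ⟨tendsto_atTop_ciSup hmono.monotone hbdd, Eventually.of_forall hσ⟩
  obtain ⟨i, hi⟩ := hl σ (pos_of_gt (hσ 0))
  obtain ⟨N, hN⟩ := eventually_atTop.1 (htend.eventually hi)
  exact ne_of_jumpTime_succ_eq hr (hτ (N + 1)) ((hN (N + 1) (by omega)).trans (hN N le_rfl).symm)

lemma lastJump_eq {n : ℕ} {t : ℝ≥0} (h1 : jumpTime y n ≤ t) (h2 : t < jumpTime y (n + 1)) :
    lastJump y t = n := by
  have hset : {m : ℕ | jumpTime y m ≤ t} = Set.Iic n := by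
    ext m
    refine ⟨fun hm => ?_, fun hm => (jumpTime_mono y hm).trans h1⟩
    by_contra hmn
    rw [Set.mem_Iic, not_le] at hmn
    exact absurd ((jumpTime_mono y hmn).trans hm) (not_le.2 h2)
  rw [lastJump, hset, csSup_Iic]

lemma lastJump_spec (hr : ∀ t, ∀ᶠ s in 𝓝[≥] t, y s = y t)
    (hl : ∀ t, 0 < t → ∃ i, ∀ᶠ s in 𝓝[<] t, y s = i) (t : ℝ≥0) :
    jumpTime y (lastJump y t) ≤ t ∧ t < jumpTime y (lastJump y t + 1) := by
  classical
  have hex := exists_lt_jumpTime hr hl t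
  obtain ⟨n, hn⟩ : ∃ n, Nat.find hex = n + 1 :=
    Nat.exists_eq_succ_of_ne_zero fun h0 => by
      have := Nat.find_spec hex
      rw [h0] at this
      exact absurd this (by simp [jumpTime])
  have h2 := Nat.find_spec hex
  rw [hn] at h2
  have h1 : jumpTime y n ≤ t := not_lt.1 (Nat.find_min hex (by omega))
  rw [lastJump_eq h1 h2]
  exact ⟨h1, h2⟩

lemma lt_jumpTime_succ_of_const (hr : ∀ t, ∀ᶠ s in 𝓝[≥] t, y s = y t) {n : ℕ} {s t : ℝ≥0}
    (h1 : jumpTime y n ≤ s) (h2 : s < jumpTime y (n + 1))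
    (hc : ∀ u, s ≤ u → u ≤ t → y u = y s) : t < jumpTime y (n + 1) := by
  by_contra hle
  rw [not_lt] at hle
  have hr' : jumpTime y (n + 1) = (jumpTime y (n + 1)).toNNReal :=
    (ENNReal.coe_toNNReal (ne_top_of_le_ne_top ENNReal.coe_ne_top hle)).symm
  refine ne_of_jumpTime_succ_eq hr hr' ((hc _ ?_ ?_).trans (eq_of_lt_jumpTime_succ h1 h2))
  · rw [hr'] at h2; exact_mod_cast h2.le
  · rw [hr'] at hle; exact_mod_cast hle

lemma jumpTime_succ_eq_of_jump (hr : ∀ t, ∀ᶠ s in 𝓝[≥] t, y s = y t) {n : ℕ} {s r : ℝ≥0}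
    (h1 : jumpTime y n ≤ s) (h2 : s < jumpTime y (n + 1)) (hsr : s ≤ r)
    (hc : ∀ u, s ≤ u → u < r → y u = y s) (hne : y r ≠ y s) : jumpTime y (n + 1) = r := by
  have hle : jumpTime y (n + 1) ≤ r := by
    rw [jumpTime]
    exact sInf_le ⟨r, ⟨h1.trans (by exact_mod_cast hsr),
      by rwa [← eq_of_lt_jumpTime_succ h1 h2]⟩, rfl⟩
  refine le_antisymm hle (not_lt.1 fun hlt => ?_)
  have hr' : jumpTime y (n + 1) = (jumpTime y (n + 1)).toNNReal :=
    (ENNReal.coe_toNNReal (ne_top_of_le_ne_top ENNReal.coe_ne_top hle)).symm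
  refine ne_of_jumpTime_succ_eq hr hr' ((hc _ ?_ ?_).trans (eq_of_lt_jumpTime_succ h1 h2))
  · rw [hr'] at h2; exact_mod_cast h2.le
  · rw [hr'] at hlt; exact_mod_cast hlt

end JumpTime

/-! ### The filtering process along one path -/

section FilterPath

variable {I O : Type*}

lemma obs_right (h : I → O) (ω : PathSpace I) (t : ℝ≥0) :
    ∀ᶠ s in 𝓝[≥] t, obs h ω s = obs h ω t :=
  (ω.2.1 t).mono fun _ hs => congrArg h hs

lemma obs_left (h : I → O) (ω : PathSpace I) (t : ℝ≥0) (ht : 0 < t) :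
    ∃ i, ∀ᶠ s in 𝓝[<] t, obs h ω s = i := by
  obtain ⟨i, hi⟩ := ω.2.2 t ht
  exact ⟨h i, hi.mono fun _ hs => congrArg h hs⟩

variable [Fintype I] [DecidableEq O] {Λ : Matrix I I ℝ} {h : I → O} {κ : O → I → ℝ} {μ : I → ℝ}

lemma filterProc_eq {ω : PathSpace I} {n : ℕ} {t : ℝ≥0} (h1 : jumpTime (obs h ω) n ≤ t)
    (h2 : t < jumpTime (obs h ω) (n + 1)) :
    filterProc Λ h κ μ t ω = flow Λ h (obs h ω t) (t - (jumpTime (obs h ω) n).toNNReal)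
      (filterAtJump Λ h κ μ (obs h ω) n) := by
  rw [filterProc, lastJump_eq h1 h2, eq_of_lt_jumpTime_succ h1 h2]

variable [DecidableEq I]

lemma filterAtJump_mem_face (hΛ : IsRateMatrix Λ) (hκ : ∀ a, κ a ∈ face h a)
    (hμ : μ ∈ stdSimplex ℝ I) {y : ℝ≥0 → O} (hr : ∀ t, ∀ᶠ s in 𝓝[≥] t, y s = y t) (n : ℕ)
    (hn : jumpTime y n ≠ ∞) :
    filterAtJump Λ h κ μ y n ∈ face h (y (jumpTime y n).toNNReal) := by
  induction n with
  | zero => exact condOp_mem_face hκ fun i _ => hμ.1 i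
  | succ n ih =>
    have hn' := ne_top_of_le_ne_top hn (jumpTime_le_succ y n)
    exact condOp_mem_face hκ fun i hi => vecMul_nonneg_of_ne hΛ
      (ne_of_jumpTime_succ_eq hr (ENNReal.coe_toNNReal hn).symm)
      (flow_mem_face hΛ (ih hn') _) i hi

lemma filterAtJump_lastJump_mem_face (hΛ : IsRateMatrix Λ) (hκ : ∀ a, κ a ∈ face h a)
    (hμ : μ ∈ stdSimplex ℝ I) {ω : PathSpace I} {n : ℕ} {t : ℝ≥0}
    (h1 : jumpTime (obs h ω) n ≤ t) (h2 : t < jumpTime (obs h ω) (n + 1)) :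
    filterAtJump Λ h κ μ (obs h ω) n ∈ face h (obs h ω t) := by
  rw [eq_of_lt_jumpTime_succ h1 h2]
  exact filterAtJump_mem_face hΛ hκ hμ (obs_right h ω) n
    (ne_top_of_le_ne_top ENNReal.coe_ne_top h1)

lemma filterProc_mem_face (hΛ : IsRateMatrix Λ) (hκ : ∀ a, κ a ∈ face h a)
    (hμ : μ ∈ stdSimplex ℝ I) (t : ℝ≥0) (ω : PathSpace I) :
    filterProc Λ h κ μ t ω ∈ face h (obs h ω t) := by
  obtain ⟨h1, h2⟩ := lastJump_spec (obs_right h ω) (obs_left h ω) t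
  rw [filterProc_eq h1 h2]
  exact flow_mem_face hΛ (filterAtJump_lastJump_mem_face hΛ hκ hμ h1 h2) _

lemma exists_vecMul_levelProj_eq_filterProc_zero (hΛ : IsRateMatrix Λ)
    (hκ : ∀ a, κ a ∈ face h a) (hμ : μ ∈ stdSimplex ℝ I) (ω : PathSpace I) :
    ∃ c ≥ (0 : ℝ), μ ᵥ* levelProj h (obs h ω 0) = c • filterProc Λ h κ μ 0 ω := by
  obtain ⟨c, hc, hcm⟩ := exists_vecMul_levelProj_eq (κ := κ) (a := obs h ω 0)
    fun i (_ : h i = obs h ω 0) => hμ.1 i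
  have hlast : lastJump (obs h ω) 0 = 0 := by
    obtain ⟨h1, h2⟩ := lastJump_spec (obs_right h ω) (obs_left h ω) 0
    by_contra hne
    obtain ⟨n, hn⟩ := Nat.exists_eq_succ_of_ne_zero hne
    have h0 : jumpTime (obs h ω) (n + 1) = (0 : ℝ≥0) := by
      rw [← Nat.succ_eq_add_one, ← hn]; exact le_antisymm h1 (by simp)
    have := jumpTime_lt_succ (obs_right h ω) h0
    rw [h0] at this
    exact absurd this (by simp)
  obtain ⟨h1, h2⟩ := lastJump_spec (obs_right h ω) (obs_left h ω) 0
  rw [hlast] at h1 h2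
  refine ⟨c, hc, ?_⟩
  rw [filterProc_eq h1 h2, hcm, zero_tsub, flow_eq hΛ]
  · have hface := condOp_mem_face hκ (a := obs h ω 0) fun i _ => hμ.1 i
    simp [killedExp_zero, filterAtJump, hface.1.2]
  · exact filterAtJump_lastJump_mem_face hΛ hκ hμ h1 h2

/-- Without a jump of the observation on `[s, t]` the unnormalized filter evolves linearly. -/
lemma exists_filterProc_vecMul_of_const (hΛ : IsRateMatrix Λ) (hκ : ∀ a, κ a ∈ face h a)
    (hμ : μ ∈ stdSimplex ℝ I) {ω : PathSpace I} {s t : ℝ≥0} (hst : s ≤ t)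
    (hc : ∀ u, s ≤ u → u ≤ t → obs h ω u = obs h ω s) :
    ∃ c ≥ (0 : ℝ), filterProc Λ h κ μ s ω ᵥ* killedExp Λ h (obs h ω s) (t - s)
      = c • filterProc Λ h κ μ t ω := by
  obtain ⟨h1, h2⟩ := lastJump_spec (obs_right h ω) (obs_left h ω) s
  have h3 := lt_jumpTime_succ_of_const (obs_right h ω) h1 h2 hc
  have hst' : (s : ℝ≥0∞) ≤ t := by exact_mod_cast hst
  have hface := filterAtJump_lastJump_mem_face hΛ hκ hμ h1 h2
  rw [filterProc_eq h1 h2, filterProc_eq (h1.trans hst') h3, hc t hst le_rfl]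
  have hT : (jumpTime (obs h ω) (lastJump (obs h ω) s)).toNNReal ≤ s :=
    ENNReal.toNNReal_mono ENNReal.coe_ne_top h1
  set T := (jumpTime (obs h ω) (lastJump (obs h ω) s)).toNNReal
  obtain ⟨c, hc0, hceq⟩ := exists_flow_vecMul_killedExp_eq hΛ hface (s - T) (t - T)
  refine ⟨c, hc0.le, ?_⟩
  rw [← hceq, NNReal.coe_sub hT, NNReal.coe_sub (hT.trans hst)]
  congr 2
  ring

/-- At a jump of the observation from `a` to `b` the unnormalized filter is multiplied by
`Λ1_b`. -/
lemma exists_filterProc_vecMul_of_jump (hΛ : IsRateMatrix Λ) (hκ : ∀ a, κ a ∈ face h a)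
    (hμ : μ ∈ stdSimplex ℝ I) {ω : PathSpace I} {s r t : ℝ≥0} (hsr : s ≤ r) (hrt : r ≤ t)
    (hc : ∀ u, s ≤ u → u < r → obs h ω u = obs h ω s)
    (hc' : ∀ u, r ≤ u → u ≤ t → obs h ω u = obs h ω r) (hne : obs h ω r ≠ obs h ω s) :
    ∃ c ≥ (0 : ℝ), filterProc Λ h κ μ s ω ᵥ* (killedExp Λ h (obs h ω s) (r - s)
      * (Λ * levelProj h (obs h ω r)) * killedExp Λ h (obs h ω r) (t - r))
      = c • filterProc Λ h κ μ t ω := by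
  obtain ⟨h1, h2⟩ := lastJump_spec (obs_right h ω) (obs_left h ω) s
  have h3 := jumpTime_succ_eq_of_jump (obs_right h ω) h1 h2 hsr hc hne
  have hface := filterAtJump_lastJump_mem_face hΛ hκ hμ h1 h2
  have h4 : r < jumpTime (obs h ω) (lastJump (obs h ω) s + 1 + 1) := by
    rw [← h3]
    by_contra hle
    rw [not_lt] at hle
    have he : jumpTime (obs h ω) (lastJump (obs h ω) s + 1 + 1) = r :=
      le_antisymm (hle.trans h3.le) (h3.symm.le.trans (jumpTime_le_succ _ _))
    have := jumpTime_lt_succ (obs_right h ω) he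
    rw [h3, he] at this
    exact lt_irrefl _ this
  obtain ⟨d, hd, hdeq⟩ := exists_filterProc_vecMul_of_const hΛ hκ hμ hrt hc'
  have hT : (jumpTime (obs h ω) (lastJump (obs h ω) s)).toNNReal ≤ s :=
    ENNReal.toNNReal_mono ENNReal.coe_ne_top h1
  have hfs := filterProc_eq (Λ := Λ) (κ := κ) (μ := μ) h1 h2
  have hfr := filterProc_eq (Λ := Λ) (κ := κ) (μ := μ) h3.le h4
  have haT := eq_of_lt_jumpTime_succ h1 h2
  rw [filterAtJump, h3, ENNReal.toNNReal_coe, tsub_self, ← haT] at hfr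
  set T := (jumpTime (obs h ω) (lastJump (obs h ω) s)).toNNReal
  set x := filterAtJump Λ h κ μ (obs h ω) (lastJump (obs h ω) s)
  have hnn := fun i (hi : h i = obs h ω r) =>
    vecMul_nonneg_of_ne hΛ hne (flow_mem_face hΛ hface (r - T)) i hi
  have hzero : ∀ z ∈ face h (obs h ω r), flow Λ h (obs h ω r) 0 z = z := fun z hz => by
    rw [flow_eq hΛ hz]
    simp [killedExp_zero, hz.1.2]
  rw [hzero _ (condOp_mem_face hκ hnn)] at hfr
  obtain ⟨c, hc0, hceq⟩ := exists_flow_vecMul_killedExp_eq hΛ hface (s - T) (r - T)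
  obtain ⟨e, he0, heeq⟩ := exists_vecMul_levelProj_eq (κ := κ) hnn
  have hrs : ((r - T : ℝ≥0) : ℝ) - (s - T : ℝ≥0) = r - s := by
    rw [NNReal.coe_sub hT, NNReal.coe_sub (hT.trans hsr)]
    ring
  rw [hrs] at hceq
  refine ⟨c * (e * d), by positivity, ?_⟩
  rw [← Matrix.vecMul_vecMul, ← Matrix.vecMul_vecMul, hfs, hceq, Matrix.smul_vecMul,
    ← Matrix.vecMul_vecMul, heeq, ← hfr, Matrix.smul_vecMul, Matrix.smul_vecMul, hdeq, mul_smul,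
    mul_smul]

end FilterPath

/-! ### One cell of the time grid -/

section Cell

variable {I O : Type*}

/-- Along `ω` the chain `X` changes its value at most once on `[s, t]`. -/
def AtMostOneJump (ω : PathSpace I) (s t : ℝ≥0) : Prop :=
  ∀ u v w, s ≤ u → u ≤ v → v ≤ w → w ≤ t → coord u ω = coord v ω ∨ coord v ω = coord w ω

lemma AtMostOneJump.obs_eq_or {ω : PathSpace I} {s t : ℝ≥0} (hω : AtMostOneJump ω s t) (h : I → O)
    {u v w : ℝ≥0} (hu : s ≤ u) (huv : u ≤ v) (hvw : v ≤ w) (hw : w ≤ t) :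
    obs h ω u = obs h ω v ∨ obs h ω v = obs h ω w :=
  (hω u v w hu huv hvw hw).imp (congrArg h) (congrArg h)

lemma AtMostOneJump.const_or_jump {ω : PathSpace I} {s t : ℝ≥0} (hω : AtMostOneJump ω s t)
    (h : I → O) (hst : s ≤ t) :
    (∀ u, s ≤ u → u ≤ t → obs h ω u = obs h ω s) ∨
    ∃ r, s ≤ r ∧ r ≤ t ∧ (∀ u, s ≤ u → u < r → obs h ω u = obs h ω s) ∧
      (∀ u, r ≤ u → u ≤ t → obs h ω u = obs h ω r) ∧ obs h ω r ≠ obs h ω s := by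
  by_cases heq : obs h ω t = obs h ω s
  · left
    intro u hu hut
    rcases hω.obs_eq_or h le_rfl hu hut le_rfl with h1 | h1
    · exact h1.symm
    · exact h1.trans heq
  · right
    set E : Set ℝ≥0 := {u | s ≤ u ∧ obs h ω u ≠ obs h ω s}
    have hE : E.Nonempty := ⟨t, hst, heq⟩
    have hbelow : ∀ u, s ≤ u → u < sInf E → obs h ω u = obs h ω s :=
      fun u hu hlt => by
        by_contra hne
        exact absurd hlt (not_lt.2 (csInf_le (OrderBot.bddBelow E) ⟨hu, hne⟩))
    have hr1 : s ≤ sInf E := le_csInf hE fun u hu => hu.1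
    have hr2 : sInf E ≤ t := csInf_le (OrderBot.bddBelow E) ⟨hst, heq⟩
    -- by right continuity the infimum is attained
    have hrne : obs h ω (sInf E) ≠ obs h ω s := by
      intro hreq
      obtain ⟨u, hu, hsub⟩ := mem_nhdsGE_iff_exists_Ico_subset.1 (obs_right h ω (sInf E))
      obtain ⟨v, hv, hvu⟩ := exists_lt_of_csInf_lt hE hu
      exact hv.2 ((hsub ⟨csInf_le (OrderBot.bddBelow E) hv, hvu⟩ :
        obs h ω v = obs h ω (sInf E)).trans hreq)
    refine ⟨sInf E, hr1, hr2, hbelow, fun u hu hut => ?_, hrne⟩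
    exact ((hω.obs_eq_or h le_rfl hr1 hu hut).resolve_left fun h1 => hrne h1.symm).symm

variable [Fintype I] [DecidableEq I] [DecidableEq O]

lemma norm_one_matrix_le : ‖(1 : Matrix I I ℝ)‖ ≤ 1 := by
  rw [← Matrix.diagonal_one, Matrix.linfty_opNorm_diagonal, pi_norm_le_iff_of_nonneg zero_le_one]
  simp

lemma norm_levelProj_mul_mul_le (h : I → O) (a b : O) (X : Matrix I I ℝ) :
    ‖levelProj h a * X * levelProj h b‖ ≤ ‖X‖ := by
  calc ‖levelProj h a * X * levelProj h b‖
      ≤ ‖levelProj h a‖ * ‖X‖ * ‖levelProj h b‖ :=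
        (norm_mul_le _ _).trans (mul_le_mul_of_nonneg_right (norm_mul_le _ _) (norm_nonneg _))
    _ ≤ 1 * ‖X‖ * 1 := by
        gcongr
        exacts [norm_levelProj_le h a, norm_levelProj_le h b]
    _ = ‖X‖ := by ring

/-- Compressed to one level set, `e^{δΛ}` and the matrix `killedExp` of a cell without a jump of the
observation agree up to `O(δ²)`: the first-order terms have the same compression. -/
lemma norm_compressed_killedExp_sub_le {Λ : Matrix I I ℝ} {C r : ℝ} (hC : 0 < C)
    (hexp : ∀ B : Matrix I I ℝ, ‖B‖ ≤ r → ‖NormedSpace.exp B - 1 - B‖ ≤ C * ‖B‖ ^ 2)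
    (h : I → O) (a : O) {δ : ℝ} (hδ : 0 ≤ δ) (hδr : δ * ‖Λ‖ ≤ r) :
    ‖levelProj h a * killedExp Λ h a δ * levelProj h a
      - levelProj h a * NormedSpace.exp (δ • Λ) * levelProj h a‖ ≤ 2 * C * ‖Λ‖ ^ 2 * δ ^ 2 := by
  set D := levelProj h a with hD
  have hDD : D * D = D := levelProj_mul_self h a
  have hΛD : ‖Λ * D‖ ≤ ‖Λ‖ := (norm_mul_le _ _).trans
    (mul_le_of_le_one_right (norm_nonneg _) (norm_levelProj_le h a))
  have hn1 : ‖δ • (Λ * D)‖ ≤ δ * ‖Λ‖ := by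
    rw [norm_smul, Real.norm_of_nonneg hδ]
    exact mul_le_mul_of_nonneg_left hΛD hδ
  have hn2 : ‖δ • Λ‖ = δ * ‖Λ‖ := by rw [norm_smul, Real.norm_of_nonneg hδ]
  have h1 := hexp _ (hn1.trans hδr)
  have h2 := hexp _ (hn2.le.trans hδr)
  rw [hn2] at h2
  have h1' : ‖NormedSpace.exp (δ • (Λ * D)) - 1 - δ • (Λ * D)‖ ≤ C * (δ * ‖Λ‖) ^ 2 :=
    h1.trans (by gcongr)
  have key : D * killedExp Λ h a δ * D - D * NormedSpace.exp (δ • Λ) * D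
      = D * ((NormedSpace.exp (δ • (Λ * D)) - 1 - δ • (Λ * D))
        - (NormedSpace.exp (δ • Λ) - 1 - δ • Λ)) * D := by
    have : D * (δ • (Λ * D)) * D = D * (δ • Λ) * D := by
      simp only [mul_smul_comm, smul_mul_assoc, mul_assoc, hDD]
    rw [killedExp, ← hD]
    simp only [mul_sub, sub_mul, this]
    abel
  rw [key]
  refine (norm_levelProj_mul_mul_le h a a _).trans ((norm_sub_le _ _).trans ?_)
  linarith [h1', h2]

/-- Compressed between two different level sets, `e^{δΛ}` and `δ` times the matrix of a cell with one
jump of the observation agree up to `O(δ²)`, wherever the jump lies in the cell. Here `σ` and `τ`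
are the times before and after the jump, and `δ = σ + τ`. -/
lemma norm_compressed_jump_sub_le {Λ : Matrix I I ℝ} {C r : ℝ} (hC : 0 < C)
    (hexp : ∀ B : Matrix I I ℝ, ‖B‖ ≤ r →
      ‖NormedSpace.exp B - 1‖ ≤ C * ‖B‖ ∧ ‖NormedSpace.exp B - 1 - B‖ ≤ C * ‖B‖ ^ 2)
    (h : I → O) {a b : O} (hab : a ≠ b) {σ τ : ℝ} (hσ : 0 ≤ σ) (hτ : 0 ≤ τ)
    (hr : (σ + τ) * ‖Λ‖ ≤ r) :
    ‖levelProj h a * ((σ + τ) •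
        (killedExp Λ h a σ * (Λ * levelProj h b) * killedExp Λ h b τ)) * levelProj h b
      - levelProj h a * NormedSpace.exp ((σ + τ) • Λ) * levelProj h b‖
      ≤ (C * (2 + C * r) + C) * ‖Λ‖ ^ 2 * (σ + τ) ^ 2 := by
  set A := levelProj h a with hA
  set D := levelProj h b with hD
  set L := ‖Λ‖
  have hL : 0 ≤ L := norm_nonneg _
  have hDD : D * D = D := levelProj_mul_self h b
  have hAD : A * D = 0 := levelProj_mul_of_ne h hab
  have hMn : ∀ c, ‖Λ * levelProj h c‖ ≤ L := fun c => (norm_mul_le _ _).trans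
    (mul_le_of_le_one_right (norm_nonneg _) (norm_levelProj_le h c))
  have hk : ∀ c u, 0 ≤ u → u * L ≤ r → ‖killedExp Λ h c u - 1‖ ≤ C * (u * L) := by
    intro c u hu hur
    have hn : ‖u • (Λ * levelProj h c)‖ ≤ u * L := by
      rw [norm_smul, Real.norm_of_nonneg hu]
      exact mul_le_mul_of_nonneg_left (hMn c) hu
    exact (hexp _ (hn.trans hur)).1.trans (by gcongr)
  have hσr : σ * L ≤ r := le_trans (by gcongr; linarith) hr
  have hτr : τ * L ≤ r := le_trans (by gcongr; linarith) hr
  have h1 := hk a σ hσ hσr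
  have h2 := hk b τ hτ hτr
  have h2' : ‖killedExp Λ h b τ‖ ≤ 1 + C * r := by
    have := norm_add_le (killedExp Λ h b τ - 1) 1
    rw [sub_add_cancel] at this
    have h3 : C * (τ * L) ≤ C * r := by gcongr
    linarith [norm_one_matrix_le (I := I)]
  have hP : ‖NormedSpace.exp ((σ + τ) • Λ) - 1 - (σ + τ) • Λ‖ ≤ C * ((σ + τ) * L) ^ 2 := by
    have hn : ‖(σ + τ) • Λ‖ = (σ + τ) * L := by
      rw [norm_smul, Real.norm_of_nonneg (add_nonneg hσ hτ)]
    rw [← hn]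
    exact (hexp _ (hn.le.trans hr)).2
  have key : A * ((σ + τ) • (killedExp Λ h a σ * (Λ * D) * killedExp Λ h b τ)) * D
      - A * NormedSpace.exp ((σ + τ) • Λ) * D
      = A * ((σ + τ) • ((killedExp Λ h a σ - 1) * (Λ * D) * killedExp Λ h b τ
          + (Λ * D) * (killedExp Λ h b τ - 1))
        - (NormedSpace.exp ((σ + τ) • Λ) - 1 - (σ + τ) • Λ)) * D := by
    have e1 : A * ((σ + τ) • (Λ * D)) * D = A * ((σ + τ) • Λ) * D := by
      simp only [mul_smul_comm, smul_mul_assoc, mul_assoc, hDD]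
    simp only [mul_sub, sub_mul, mul_add, add_mul, smul_add, smul_sub, one_mul, mul_one]
    rw [e1, hAD]
    abel
  rw [key]
  refine (norm_levelProj_mul_mul_le h a b _).trans ((norm_sub_le _ _).trans ?_)
  rw [norm_smul, Real.norm_of_nonneg (add_nonneg hσ hτ)]
  have hb1 : ‖(killedExp Λ h a σ - 1) * (Λ * D) * killedExp Λ h b τ‖
      ≤ C * (σ * L) * L * (1 + C * r) :=
    (norm_mul_le _ _).trans (mul_le_mul ((norm_mul_le _ _).trans
      (mul_le_mul h1 (hMn b) (norm_nonneg _) (by positivity))) h2' (norm_nonneg _) (by positivity))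
  have hb2 : ‖(Λ * D) * (killedExp Λ h b τ - 1)‖ ≤ L * (C * (τ * L)) :=
    (norm_mul_le _ _).trans (mul_le_mul (hMn b) h2 (norm_nonneg _) hL)
  have hr0 : 0 ≤ r := le_trans (by positivity) hr
  have hb3 : ‖(killedExp Λ h a σ - 1) * (Λ * D) * killedExp Λ h b τ
      + (Λ * D) * (killedExp Λ h b τ - 1)‖ ≤ C * (2 + C * r) * L ^ 2 * (σ + τ) := by
    refine (norm_add_le _ _).trans ((add_le_add hb1 hb2).trans ?_)
    have e1 : C * (σ * L) * L * (1 + C * r) = C * (1 + C * r) * L ^ 2 * σ := by ring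
    have e2 : L * (C * (τ * L)) = C * 1 * L ^ 2 * τ := by ring
    rw [e1, e2, mul_add (C * (2 + C * r) * L ^ 2)]
    have : 0 ≤ C * r := by positivity
    gcongr <;> linarith
  calc (σ + τ) * ‖(killedExp Λ h a σ - 1) * (Λ * D) * killedExp Λ h b τ
        + (Λ * D) * (killedExp Λ h b τ - 1)‖
        + ‖NormedSpace.exp ((σ + τ) • Λ) - 1 - (σ + τ) • Λ‖
      ≤ (σ + τ) * (C * (2 + C * r) * L ^ 2 * (σ + τ)) + C * ((σ + τ) * L) ^ 2 := by gcongr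
    _ = (C * (2 + C * r) + C) * L ^ 2 * (σ + τ) ^ 2 := by ring

/-- On a cell of length `δ` with at most one jump, the unnormalized filter is transformed by a
matrix whose compression to the observed level sets is within `O(δ²)` of that of `e^{δΛ}`.
In the case of a jump the matrix carries the factor `δ`, which the normalization removes. -/
lemma exists_cell_matrix (Λ : Matrix I I ℝ) (hΛ : IsRateMatrix Λ) :
    ∃ B > 0, ∃ δ₀ > 0, ∀ (h : I → O) (κ : O → I → ℝ) (μ : I → ℝ),
      (∀ a, κ a ∈ face h a) → μ ∈ stdSimplex ℝ I → ∀ δ : ℝ≥0, (δ : ℝ) ≤ δ₀ →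
      (∀ a b, ‖levelProj h a * NormedSpace.exp ((δ : ℝ) • Λ) * levelProj h b‖
        ≤ (if a = b then 1 else 0) + B * δ) ∧
      ‖NormedSpace.exp ((δ : ℝ) • Λ) - 1‖ ≤ B * δ ∧
      ∀ (s : ℝ≥0) (ω : PathSpace I), AtMostOneJump ω s (s + δ) →
        ∃ S : Matrix I I ℝ,
          (∃ c ≥ (0 : ℝ), filterProc Λ h κ μ s ω ᵥ* S = c • filterProc Λ h κ μ (s + δ) ω) ∧
          ‖levelProj h (obs h ω s) * S * levelProj h (obs h ω (s + δ))‖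
            ≤ (if obs h ω s = obs h ω (s + δ) then 1 else 0) + B * δ ∧
          ‖levelProj h (obs h ω s) * S * levelProj h (obs h ω (s + δ))
            - levelProj h (obs h ω s) * NormedSpace.exp ((δ : ℝ) • Λ)
              * levelProj h (obs h ω (s + δ))‖ ≤ B * δ ^ 2 := by
  obtain ⟨C, hC, r, hr, hexp⟩ := exists_norm_exp_sub_le (Matrix I I ℝ)
  set L := ‖Λ‖
  have hL : 0 ≤ L := norm_nonneg _
  set K := (C * (2 + C * r) + C) * L ^ 2 with hKdef
  have hK : 0 ≤ K := by positivity
  have hK2 : 2 * C * L ^ 2 ≤ K := by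
    rw [hKdef]
    have : 0 ≤ C * (C * r) := by positivity
    gcongr
    linarith
  refine ⟨C * L + K + 1, by positivity, min 1 (r / (L + 1)), by positivity,
    fun h κ μ hκ hμ δ hδ => ?_⟩
  have hδ0 : (0 : ℝ) ≤ δ := δ.coe_nonneg
  have hδ1 : (δ : ℝ) ≤ 1 := hδ.trans (min_le_left _ _)
  have hδr : (δ : ℝ) * L ≤ r := by
    have := hδ.trans (min_le_right _ _)
    rw [le_div_iff₀ (by positivity)] at this
    linarith
  have hn : ‖(δ : ℝ) • Λ‖ = δ * L := by rw [norm_smul, Real.norm_of_nonneg hδ0]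
  have hP : ‖NormedSpace.exp ((δ : ℝ) • Λ) - 1‖ ≤ C * L * δ := by
    have := (hexp _ (hn.le.trans hδr)).1
    rw [hn] at this
    exact this.trans_eq (by ring)
  have hblock : ∀ a b, ‖levelProj h a * NormedSpace.exp ((δ : ℝ) • Λ) * levelProj h b‖
      ≤ (if a = b then 1 else 0) + C * L * δ := by
    intro a b
    split_ifs with hab
    · refine (norm_levelProj_mul_mul_le h a b _).trans ?_
      have := norm_add_le (NormedSpace.exp ((δ : ℝ) • Λ) - 1) 1
      rw [sub_add_cancel] at this
      linarith [norm_one_matrix_le (I := I)]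
    · have : levelProj h a * NormedSpace.exp ((δ : ℝ) • Λ) * levelProj h b
          = levelProj h a * (NormedSpace.exp ((δ : ℝ) • Λ) - 1) * levelProj h b := by
        rw [mul_sub, sub_mul, mul_one, levelProj_mul_of_ne h hab, sub_zero]
      rw [this, zero_add]
      exact (norm_levelProj_mul_mul_le h a b _).trans hP
  have hsq : (δ : ℝ) ^ 2 ≤ δ := by nlinarith
  have hBδ : C * L * δ + K * δ ^ 2 ≤ (C * L + K + 1) * δ := by nlinarith
  have hCLδ : C * L * δ ≤ (C * L + K + 1) * δ := by gcongr; linarith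
  refine ⟨fun a b => (hblock a b).trans (by gcongr), hP.trans hCLδ, fun s ω hω => ?_⟩
  suffices hS : ∃ S : Matrix I I ℝ,
      (∃ c ≥ (0 : ℝ), filterProc Λ h κ μ s ω ᵥ* S = c • filterProc Λ h κ μ (s + δ) ω) ∧
      ‖levelProj h (obs h ω s) * S * levelProj h (obs h ω (s + δ))
        - levelProj h (obs h ω s) * NormedSpace.exp ((δ : ℝ) • Λ)
          * levelProj h (obs h ω (s + δ))‖ ≤ K * δ ^ 2 by
    obtain ⟨S, hS1, hS2⟩ := hS
    refine ⟨S, hS1, ?_, hS2.trans (by gcongr; nlinarith)⟩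
    have h1 := norm_add_le (levelProj h (obs h ω s) * S * levelProj h (obs h ω (s + δ))
        - levelProj h (obs h ω s) * NormedSpace.exp ((δ : ℝ) • Λ)
          * levelProj h (obs h ω (s + δ))) (levelProj h (obs h ω s)
            * NormedSpace.exp ((δ : ℝ) • Λ) * levelProj h (obs h ω (s + δ)))
    rw [sub_add_cancel] at h1
    have h2 := hblock (obs h ω s) (obs h ω (s + δ))
    linarith
  rcases hω.const_or_jump h le_self_add with hc | ⟨q, hsq', hqt, hc1, hc2, hne⟩
  · obtain ⟨c, hc0, hceq⟩ := exists_filterProc_vecMul_of_const hΛ hκ hμ le_self_add hc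
    refine ⟨killedExp Λ h (obs h ω s) δ, ⟨c, hc0, ?_⟩, ?_⟩
    · rw [← hceq]
      congr 2
      push_cast
      ring
    · rw [hc _ le_self_add le_rfl]
      refine (norm_compressed_killedExp_sub_le hC (fun B hB => (hexp B hB).2) h _ hδ0 hδr).trans ?_
      gcongr
  · obtain ⟨c, hc0, hceq⟩ := exists_filterProc_vecMul_of_jump hΛ hκ hμ hsq' hqt hc1 hc2 hne
    have hst : ((q : ℝ) - s) + (((s + δ : ℝ≥0) : ℝ) - q) = δ := by
      push_cast
      ring
    have h1 : (0 : ℝ) ≤ (q : ℝ) - s := sub_nonneg.2 (by exact_mod_cast hsq')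
    have h2 : (0 : ℝ) ≤ ((s + δ : ℝ≥0) : ℝ) - q := sub_nonneg.2 (by exact_mod_cast hqt)
    refine ⟨(δ : ℝ) • (killedExp Λ h (obs h ω s) (q - s) * (Λ * levelProj h (obs h ω q))
      * killedExp Λ h (obs h ω q) ((s + δ : ℝ≥0) - q)), ⟨δ * c, by positivity, ?_⟩, ?_⟩
    · rw [Matrix.vecMul_smul, hceq, mul_smul]
    · rw [hc2 _ hqt le_rfl]
      have := norm_compressed_jump_sub_le hC hexp h hne.symm h1 h2 (by rw [hst]; exact hδr)
      rw [hst] at this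
      exact this

end Cell

/-! ### The filter on a time grid -/

section Grid

variable {I O : Type*}

/-- The observations at the grid points `0, δ, …, Nδ`. -/
def gridObs (h : I → O) (δ : ℝ≥0) (N : ℕ) (ω : PathSpace I) : Fin (N + 1) → O :=
  fun k => obs h ω (k * δ)

lemma init_gridObs (h : I → O) (δ : ℝ≥0) (N : ℕ) (ω : PathSpace I) :
    Fin.init (gridObs h δ (N + 1) ω) = gridObs h δ N ω := by
  ext k
  simp [Fin.init, gridObs]

lemma gridObs_last (h : I → O) (δ : ℝ≥0) (N : ℕ) (ω : PathSpace I) :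
    gridObs h δ N ω (Fin.last N) = obs h ω (N * δ) := by
  simp [gridObs]

lemma sum_fin_succ_pi [Fintype O] {N : ℕ} (F : (Fin (N + 1) → O) → O → ℝ) :
    ∑ y : Fin (N + 1 + 1) → O, F (Fin.init y) (y (Fin.last (N + 1))) = ∑ z, ∑ b, F z b := by
  rw [← (Fin.snocEquiv fun _ : Fin (N + 1 + 1) => O).sum_comp, Fintype.sum_prod_type_right]
  simp [Fin.snocEquiv]

/-- If `cπ` is `e`-close in `ℓ¹` to `ρ`, then the probability vector `π` is `2e/p`-close to
the normalization of `ρ`, where `p` is the mass of `ρ`. The value of `c` does not matter. -/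
lemma dist_normalize_le [Fintype I] {π ρ : I → ℝ} {c e : ℝ} (hπ : π ∈ stdSimplex ℝ I)
    (hρ : 0 < ∑ j, ρ j) (he : ∑ j, |c * π j - ρ j| ≤ e) :
    dist π ((∑ j, ρ j)⁻¹ • ρ) ≤ 2 * e / ∑ j, ρ j := by
  set p := ∑ j, ρ j with hp
  have he0 : 0 ≤ e := (Finset.sum_nonneg fun j _ => abs_nonneg _).trans he
  have hcp : |c - p| ≤ e := by
    have : c - p = ∑ j, (c * π j - ρ j) := by
      rw [Finset.sum_sub_distrib, ← Finset.mul_sum, hπ.2, mul_one]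
    rw [this]
    exact (Finset.abs_sum_le_sum_abs _ _).trans he
  rw [dist_pi_le_iff (by positivity)]
  intro i
  have hi : |c * π i - ρ i| ≤ e :=
    (Finset.single_le_sum (f := fun j => |c * π j - ρ j|) (fun j _ => abs_nonneg _)
      (Finset.mem_univ i)).trans he
  have hπi : |π i| ≤ 1 := by
    rw [abs_of_nonneg (hπ.1 i), ← hπ.2]
    exact Finset.single_le_sum (f := π) (fun j _ => hπ.1 j) (Finset.mem_univ i)
  have key : π i - p⁻¹ * ρ i = ((c * π i - ρ i) - (c - p) * π i) / p := by
    field_simp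
    ring
  rw [Real.dist_eq, Pi.smul_apply, smul_eq_mul, key, abs_div, abs_of_pos hρ]
  gcongr
  refine (abs_sub _ _).trans ?_
  rw [abs_mul]
  have : |c - p| * |π i| ≤ e * 1 := by gcongr
  linarith

variable [DecidableEq O]

/-- The product over the cells of the bounds `1_{a = b} + b₀` for the one-cell matrices. -/
def gridWeight (b₀ : ℝ) : (N : ℕ) → (Fin (N + 1) → O) → ℝ
  | 0, _ => 1
  | N + 1, y => gridWeight b₀ N (Fin.init y) *
      ((if Fin.init y (Fin.last N) = y (Fin.last (N + 1)) then 1 else 0) + b₀)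

/-- The accumulated error of a product of one-cell matrices bounded as in `gridWeight`, when
each factor is perturbed by at most `q`. -/
def gridErr (b₀ q : ℝ) : (N : ℕ) → (Fin (N + 1) → O) → ℝ
  | 0, _ => 0
  | N + 1, y => gridErr b₀ q N (Fin.init y) *
      ((if Fin.init y (Fin.last N) = y (Fin.last (N + 1)) then 1 else 0) + b₀)
      + gridWeight b₀ N (Fin.init y) * q

lemma gridWeight_nonneg {b₀ : ℝ} (hb : 0 ≤ b₀) (N : ℕ) (y : Fin (N + 1) → O) :
    0 ≤ gridWeight b₀ N y := by
  induction N with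
  | zero => simp [gridWeight]
  | succ N ih =>
    rw [gridWeight]
    refine mul_nonneg (ih _) ?_
    split_ifs <;> linarith

lemma gridErr_nonneg {b₀ q : ℝ} (hb : 0 ≤ b₀) (hq : 0 ≤ q) (N : ℕ) (y : Fin (N + 1) → O) :
    0 ≤ gridErr b₀ q N y := by
  induction N with
  | zero => simp [gridErr]
  | succ N ih =>
    rw [gridErr]
    refine add_nonneg (mul_nonneg (ih _) ?_) (mul_nonneg (gridWeight_nonneg hb N _) hq)
    split_ifs <;> linarith

lemma sum_gridWeight [Fintype O] (b₀ : ℝ) (N : ℕ) :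
    ∑ y : Fin (N + 1) → O, gridWeight b₀ N y
      = Fintype.card O * (1 + Fintype.card O * b₀) ^ N := by
  induction N with
  | zero => simp [gridWeight]
  | succ N ih =>
    simp only [gridWeight]
    rw [sum_fin_succ_pi fun z b => gridWeight b₀ N z * ((if z (Fin.last N) = b then 1 else 0) + b₀)]
    simp only [← Finset.mul_sum, Finset.sum_add_distrib, Finset.sum_ite_eq, Finset.mem_univ,
      if_true, Finset.sum_const, Finset.card_univ, nsmul_eq_mul, ← Finset.sum_mul, ih]
    ring

lemma sum_gridErr_le [Fintype O] {b₀ q : ℝ} (hb : 0 ≤ b₀) (hq : 0 ≤ q) (N : ℕ) :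
    ∑ y : Fin (N + 1) → O, gridErr b₀ q N y
      ≤ Fintype.card O * N * (Fintype.card O * q) * (1 + Fintype.card O * b₀) ^ N := by
  induction N with
  | zero => simp [gridErr]
  | succ N ih =>
    simp only [gridErr]
    rw [sum_fin_succ_pi fun z b => gridErr b₀ q N z * ((if z (Fin.last N) = b then 1 else 0) + b₀)
      + gridWeight b₀ N z * q]
    simp only [Finset.sum_add_distrib, ← Finset.mul_sum, Finset.sum_ite_eq, Finset.mem_univ,
      if_true, Finset.sum_const, Finset.card_univ, nsmul_eq_mul, ← Finset.sum_mul, sum_gridWeight]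
    set g := 1 + (Fintype.card O : ℝ) * b₀
    set n := (Fintype.card O : ℝ)
    have hn : 0 ≤ n := Nat.cast_nonneg _
    have hg : 1 ≤ g := le_add_of_nonneg_right (by positivity)
    calc (∑ i : Fin (N + 1) → O, gridErr b₀ q N i) * g + n * g ^ N * (n * q)
        ≤ (n * N * (n * q) * g ^ N) * g + n * (n * q) * (g ^ N * g) := by
          have h1 : g ^ N ≤ g ^ N * g := le_mul_of_one_le_right (by positivity) hg
          have h2 : n * g ^ N * (n * q) = n * (n * q) * g ^ N := by ring
          rw [h2]
          gcongr
      _ = n * ((N + 1 : ℕ) : ℝ) * (n * q) * g ^ (N + 1) := by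
          push_cast
          ring

variable [Fintype I] [DecidableEq I]

/-- The matrix `1_{y₀} Q 1_{y₁} Q ⋯ Q 1_{y_N}`. For `Q = e^{δΛ}` it maps the initial distribution to
the joint mass of the observation pattern `y` on the grid and the state at time `Nδ`. -/
def gridProd (Q : Matrix I I ℝ) (h : I → O) : (N : ℕ) → (Fin (N + 1) → O) → Matrix I I ℝ
  | 0, y => levelProj h (y 0)
  | N + 1, y => gridProd Q h N (Fin.init y) * Q * levelProj h (y (Fin.last (N + 1)))

lemma gridProd_mul_levelProj (Q : Matrix I I ℝ) (h : I → O) (N : ℕ) (y : Fin (N + 1) → O) :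
    gridProd Q h N y * levelProj h (y (Fin.last N)) = gridProd Q h N y := by
  cases N with
  | zero => exact levelProj_mul_self h _
  | succ N => rw [gridProd, mul_assoc, levelProj_mul_self]

lemma norm_gridProd_le {Q : Matrix I I ℝ} {h : I → O} {b₀ : ℝ} (hb : 0 ≤ b₀)
    (hQ : ∀ a b, ‖levelProj h a * Q * levelProj h b‖ ≤ (if a = b then 1 else 0) + b₀)
    (N : ℕ) (y : Fin (N + 1) → O) : ‖gridProd Q h N y‖ ≤ gridWeight b₀ N y := by
  induction N with
  | zero => exact norm_levelProj_le h _
  | succ N ih =>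
    rw [gridProd, gridWeight, ← gridProd_mul_levelProj]
    have : gridProd Q h N (Fin.init y) * levelProj h (Fin.init y (Fin.last N)) * Q
        * levelProj h (y (Fin.last (N + 1))) = gridProd Q h N (Fin.init y)
        * (levelProj h (Fin.init y (Fin.last N)) * Q * levelProj h (y (Fin.last (N + 1)))) := by
      simp only [mul_assoc]
    rw [this]
    exact (norm_mul_le _ _).trans
      (mul_le_mul (ih _) (hQ _ _) (norm_nonneg _) (gridWeight_nonneg hb _ _))

/-- Multiplying the one-cell matrices of a path without double jumps within a cell: up to
normalization, the filter at time `Nδ` is the image of the initial distribution under a matrix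
close to `gridProd`. -/
lemma exists_grid_matrix {Λ : Matrix I I ℝ} {h : I → O} {κ : O → I → ℝ} {μ : I → ℝ}
    (hΛ : IsRateMatrix Λ) (hκ : ∀ a, κ a ∈ face h a) (hμ : μ ∈ stdSimplex ℝ I)
    {δ : ℝ≥0} {Q : Matrix I I ℝ} {b₀ q : ℝ} (hb : 0 ≤ b₀) (hq : 0 ≤ q)
    (hQ : ∀ a b, ‖levelProj h a * Q * levelProj h b‖ ≤ (if a = b then 1 else 0) + b₀)
    {ω : PathSpace I}
    (hcell : ∀ s, AtMostOneJump ω s (s + δ) → ∃ S : Matrix I I ℝ,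
      (∃ c ≥ (0 : ℝ), filterProc Λ h κ μ s ω ᵥ* S = c • filterProc Λ h κ μ (s + δ) ω) ∧
      ‖levelProj h (obs h ω s) * S * levelProj h (obs h ω (s + δ))‖
        ≤ (if obs h ω s = obs h ω (s + δ) then 1 else 0) + b₀ ∧
      ‖levelProj h (obs h ω s) * S * levelProj h (obs h ω (s + δ))
        - levelProj h (obs h ω s) * Q * levelProj h (obs h ω (s + δ))‖ ≤ q)
    (N : ℕ) (hω : ∀ k < N, AtMostOneJump ω (k * δ) (k * δ + δ)) :
    ∃ W : Matrix I I ℝ, (∃ c ≥ (0 : ℝ), μ ᵥ* W = c • filterProc Λ h κ μ (N * δ) ω) ∧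
      W * levelProj h (obs h ω (N * δ)) = W ∧
      ‖W - gridProd Q h N (gridObs h δ N ω)‖ ≤ gridErr b₀ q N (gridObs h δ N ω) := by
  induction N with
  | zero =>
    refine ⟨levelProj h (obs h ω 0), ?_, ?_, ?_⟩
    · simpa using exists_vecMul_levelProj_eq_filterProc_zero hΛ hκ hμ ω
    · simpa using levelProj_mul_self h _
    · simp [gridProd, gridObs, gridErr]
  | succ N ih =>
    obtain ⟨W, ⟨c, hc, hW⟩, hWD, hWn⟩ := ih fun k hk => hω k (by omega)
    obtain ⟨S, ⟨d, hd, hS⟩, hS1, hS2⟩ := hcell _ (hω N (by omega))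
    have hN : (N : ℝ≥0) * δ + δ = (N + 1 : ℕ) * δ := by push_cast; ring
    rw [hN] at hS hS1 hS2
    set D := levelProj h (obs h ω (N * δ))
    set D' := levelProj h (obs h ω ((N + 1 : ℕ) * δ))
    refine ⟨W * S * D', ⟨c * d, by positivity, ?_⟩, ?_, ?_⟩
    · rw [← Matrix.vecMul_vecMul, ← Matrix.vecMul_vecMul, hW, Matrix.smul_vecMul, hS,
        Matrix.smul_vecMul, Matrix.smul_vecMul,
        vecMul_levelProj_of_mem_face (filterProc_mem_face hΛ hκ hμ _ ω), mul_smul]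
    · rw [mul_assoc, levelProj_mul_self]
    · rw [gridProd, gridErr, init_gridObs, gridObs_last, gridObs_last]
      set A := gridProd Q h N (gridObs h δ N ω)
      have hAD : A * D = A := by
        have := gridProd_mul_levelProj Q h N (gridObs h δ N ω)
        rwa [gridObs_last] at this
      have key : W * S * D' - A * Q * D'
          = (W - A) * (D * S * D') + A * (D * S * D' - D * Q * D') := by
        have e1 : W * S * D' = W * (D * S * D') := by simp only [← mul_assoc, hWD]
        have e2 : A * Q * D' = A * (D * Q * D') := by simp only [← mul_assoc, hAD]
        rw [e1, e2]
        noncomm_ring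
      rw [key]
      refine (norm_add_le _ _).trans (add_le_add ?_ ?_)
      · exact (norm_mul_le _ _).trans
          (mul_le_mul hWn hS1 (norm_nonneg _) (gridErr_nonneg hb hq _ _))
      · exact (norm_mul_le _ _).trans (mul_le_mul (norm_gridProd_le hb hQ N _) hS2
          (norm_nonneg _) (gridWeight_nonneg hb _ _))

lemma sum_abs_row_le_norm (M : Matrix I I ℝ) (i : I) : ∑ j, |M i j| ≤ ‖M‖ := by
  rw [Matrix.linfty_opNorm_def]
  have := Finset.le_sup (f := fun i : I => ∑ j : I, ‖M i j‖₊) (Finset.mem_univ i)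
  have h2 : ((∑ j : I, ‖M i j‖₊ : ℝ≥0) : ℝ) = ∑ j, |M i j| := by
    push_cast
    rfl
  rw [← h2]
  exact_mod_cast this

lemma sum_abs_vecMul_le {μ : I → ℝ} (hμ : μ ∈ stdSimplex ℝ I) (M : Matrix I I ℝ) :
    ∑ j, |(μ ᵥ* M) j| ≤ ‖M‖ := by
  calc ∑ j, |(μ ᵥ* M) j| ≤ ∑ j, ∑ i, μ i * |M i j| :=
        Finset.sum_le_sum fun j _ => (Finset.abs_sum_le_sum_abs _ _).trans
          (Finset.sum_le_sum fun i _ => by rw [abs_mul, abs_of_nonneg (hμ.1 i)])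
    _ = ∑ i, μ i * ∑ j, |M i j| := by
        rw [Finset.sum_comm]
        simp_rw [Finset.mul_sum]
    _ ≤ ∑ i, μ i * ‖M‖ :=
        Finset.sum_le_sum fun i _ => mul_le_mul_of_nonneg_left (sum_abs_row_le_norm M i) (hμ.1 i)
    _ = ‖M‖ := by rw [← Finset.sum_mul, hμ.2, one_mul]

end Grid

/-! ### Finite-dimensional distributions of the chain -/

section Law

variable {I O : Type*}

lemma measurableSet_natFilt_coord {s t : ℝ≥0} (hst : s ≤ t) (A : Set I) :
    MeasurableSet[natFilt I t] {ω | coord s ω ∈ A} :=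
  le_iSup₂ (f := fun (s : ℝ≥0) (_ : s ≤ t) => MeasurableSpace.comap (coord (I := I) s) ⊤) s hst _
    ⟨A, trivial, rfl⟩

lemma natFilt_le (t : ℝ≥0) : natFilt I t ≤ (inferInstance : MeasurableSpace (PathSpace I)) :=
  iSup₂_le fun s _ => le_iSup (fun t : ℝ≥0 => MeasurableSpace.comap (coord (I := I) t) ⊤) s

lemma measurableSet_coord (t : ℝ≥0) (A : Set I) : MeasurableSet {ω | coord t ω ∈ A} :=
  natFilt_le t _ (measurableSet_natFilt_coord le_rfl A)

lemma measurableSet_natFilt_coord_ne [Countable I] {s t u : ℝ≥0} (hs : s ≤ u) (ht : t ≤ u) :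
    MeasurableSet[natFilt I u] {ω : PathSpace I | coord s ω ≠ coord t ω} := by
  have : {ω : PathSpace I | coord s ω ≠ coord t ω}
      = ⋃ i : I, {ω | coord s ω ∈ ({i} : Set I)} ∩ {ω | coord t ω ∈ ({i}ᶜ : Set I)} := by
    ext ω
    simp [eq_comm]
  rw [this]
  exact MeasurableSet.iUnion fun i => MeasurableSet.inter
    (measurableSet_natFilt_coord hs _) (measurableSet_natFilt_coord ht _)

lemma measurableSet_gridObs_eq (h : I → O) (δ : ℝ≥0) (N : ℕ) (y : Fin (N + 1) → O) :
    MeasurableSet[natFilt I (N * δ)] {ω | gridObs h δ N ω = y} := by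
  have : {ω : PathSpace I | gridObs h δ N ω = y}
      = ⋂ k : Fin (N + 1), {ω | coord (k * δ) ω ∈ h ⁻¹' {y k}} := by
    ext ω
    simp [funext_iff, gridObs, obs]
  rw [this]
  refine MeasurableSet.iInter fun k => measurableSet_natFilt_coord ?_ _
  gcongr
  exact_mod_cast Nat.le_of_lt_succ k.2

variable [Fintype I] [DecidableEq I] {Λ : Matrix I I ℝ} {μ : I → ℝ} {P : Measure (PathSpace I)}

omit [DecidableEq I] in
lemma measureReal_eq_sum_coord [IsFiniteMeasure P] {E : Set (PathSpace I)} (hE : MeasurableSet E)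
    (t : ℝ≥0) : P.real E = ∑ i, P.real (E ∩ {ω | coord t ω = i}) := by
  rw [← measureReal_biUnion_finset]
  · congr 1
    ext ω
    simp
  · intro i _ j _ hij
    refine Set.disjoint_left.2 fun ω h1 h2 => hij ?_
    exact (h1.2 : coord t ω = i).symm.trans h2.2
  · exact fun i _ => hE.inter (measurableSet_coord t {i})

/-- The Markov property for events: the transition probabilities of the chain are the entries of
`e^{sΛ}`. -/
lemma IsMarkovLaw.measureReal_inter (hP : IsMarkovLaw Λ μ P) {t : ℝ≥0} (s : ℝ≥0) {i : I}
    {G : Set (PathSpace I)} (hG : MeasurableSet[natFilt I t] G) (hGi : ∀ ω ∈ G, coord t ω = i)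
    (j : I) :
    P.real (G ∩ {ω | coord (t + s) ω = j}) = P.real G * NormedSpace.exp ((s : ℝ) • Λ) i j := by
  have := hP.prob
  set f : I → ℝ := Pi.single j 1
  have hG' : MeasurableSet G := natFilt_le t _ hG
  have hJ : MeasurableSet {ω : PathSpace I | coord (t + s) ω = j} := measurableSet_coord _ {j}
  have hf : (fun ω : PathSpace I => f (coord (t + s) ω))
      = Set.indicator {ω | coord (t + s) ω = j} 1 := by
    ext ω
    by_cases hω : coord (t + s) ω = j
    · simp [f, hω]
    · simp [f, hω]
  have hint : Integrable (fun ω : PathSpace I => f (coord (t + s) ω)) P := by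
    rw [hf]
    exact (integrable_const (1 : ℝ)).indicator hJ
  have h1 := setIntegral_condExp (natFilt_le t) hint hG
  have h2 : ∫ ω in G, (P[fun ω => f (coord (t + s) ω) | natFilt I t]) ω ∂P
      = ∫ ω in G, NormedSpace.exp ((s : ℝ) • Λ) i j ∂P := by
    refine setIntegral_congr_ae hG' ((hP.markov t s f).mono fun ω hω hωG => ?_)
    rw [hω]
    simp [hGi ω hωG, f]
  rw [h2, setIntegral_const, smul_eq_mul, hf, setIntegral_indicator hJ] at h1
  simpa using h1.symm

lemma abs_apply_le_norm (A : Matrix I I ℝ) (i j : I) : |A i j| ≤ ‖A‖ :=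
  (Finset.single_le_sum (f := fun j => |A i j|) (fun _ _ => abs_nonneg _)
    (Finset.mem_univ j)).trans (sum_abs_row_le_norm A i)

lemma IsMarkovLaw.measureReal_inter_ne_le (hP : IsMarkovLaw Λ μ P) (t s : ℝ≥0)
    {G : Set (PathSpace I)} (hG : MeasurableSet[natFilt I t] G) :
    P.real (G ∩ {ω | coord t ω ≠ coord (t + s) ω})
      ≤ P.real G * ‖NormedSpace.exp ((s : ℝ) • Λ) - 1‖ := by
  have := hP.prob
  have hG' : MeasurableSet G := natFilt_le t _ hG
  have hne : MeasurableSet {ω : PathSpace I | coord t ω ≠ coord (t + s) ω} :=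
    natFilt_le _ _ (measurableSet_natFilt_coord_ne le_self_add le_rfl)
  rw [measureReal_eq_sum_coord (hG'.inter hne) t, measureReal_eq_sum_coord hG' t, Finset.sum_mul]
  refine Finset.sum_le_sum fun i _ => ?_
  set Gi := G ∩ {ω | coord t ω = i}
  have hGi : MeasurableSet[natFilt I t] Gi :=
    hG.inter (measurableSet_natFilt_coord le_rfl {i})
  have h1 := hP.measureReal_inter s hGi (i := i) (fun ω hω => hω.2) i
  have h2 := measureReal_sdiff_add_inter (μ := P) (s := Gi)
    (measurableSet_coord (I := I) (t + s) {i})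
  have h3 : G ∩ {ω | coord t ω ≠ coord (t + s) ω} ∩ {ω | coord t ω = i}
      = Gi \ {ω | coord (t + s) ω ∈ ({i} : Set I)} := by
    ext ω
    simp only [Gi, Set.mem_inter_iff, Set.mem_ofPred_eq, Set.mem_sdiff, Set.mem_singleton_iff]
    constructor
    · rintro ⟨⟨a, b⟩, c⟩
      exact ⟨⟨a, c⟩, fun d => b (c.trans d.symm)⟩
    · rintro ⟨⟨a, c⟩, b⟩
      exact ⟨⟨a, fun d => b (d.symm.trans c)⟩, c⟩
  have h4 := abs_apply_le_norm (NormedSpace.exp ((s : ℝ) • Λ) - 1) i i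
  rw [Matrix.sub_apply, Matrix.one_apply_eq, abs_sub_comm] at h4
  have h5 := (le_abs_self _).trans h4
  simp only [Set.mem_singleton_iff] at h2 h3
  rw [h3]
  have h6 : P.real (Gi \ {ω | coord (t + s) ω = i})
      = P.real Gi * (1 - NormedSpace.exp ((s : ℝ) • Λ) i i) := by
    linarith
  rw [h6]
  exact mul_le_mul_of_nonneg_left h5 measureReal_nonneg

variable [DecidableEq O]

/-- The entries of `μ 1_{y₀} e^{δΛ} 1_{y₁} ⋯ 1_{y_N}` are the joint probabilities of the observed
pattern `y` on the grid and the final state. -/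
lemma IsMarkovLaw.measureReal_gridObs_coord (hP : IsMarkovLaw Λ μ P) (hμ : μ ∈ stdSimplex ℝ I)
    (h : I → O) (δ : ℝ≥0) (N : ℕ) (y : Fin (N + 1) → O) (i : I) :
    P.real ({ω | gridObs h δ N ω = y} ∩ {ω | coord (N * δ) ω = i})
      = (μ ᵥ* gridProd (NormedSpace.exp ((δ : ℝ) • Λ)) h N y) i := by
  have := hP.prob
  induction N generalizing i with
  | zero =>
    rw [gridProd, vecMul_levelProj, Pi.mul_apply, levelInd]
    have hi : P.real {ω | coord 0 ω = i} = μ i := by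
      rw [measureReal_def, hP.init, ENNReal.toReal_ofReal (hμ.1 i)]
    split_ifs with hy
    · rw [one_mul, ← hi]
      congr 1
      ext ω
      simp only [Nat.cast_zero, zero_mul, Set.mem_inter_iff, Set.mem_ofPred_eq, and_iff_right_iff_imp]
      rintro rfl
      ext k
      obtain rfl : k = 0 := Fin.fin_one_eq_zero k
      simpa [gridObs, obs] using hy
    · rw [zero_mul]
      convert measureReal_empty
      ext ω
      simp only [Nat.cast_zero, zero_mul, Set.mem_inter_iff, Set.mem_ofPred_eq,
        Set.mem_empty_iff_false, iff_false, not_and]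
      rintro rfl rfl
      simp [gridObs, obs] at hy
  | succ N ih =>
    rw [gridProd, ← Matrix.vecMul_vecMul, vecMul_levelProj, Pi.mul_apply, levelInd,
      ← Matrix.vecMul_vecMul]
    have hN : ((N + 1 : ℕ) : ℝ≥0) * δ = N * δ + δ := by push_cast; ring
    have hsplit : ∀ ω, gridObs h δ (N + 1) ω = y ↔
        gridObs h δ N ω = Fin.init y ∧ obs h ω (N * δ + δ) = y (Fin.last (N + 1)) := by
      intro ω
      rw [← hN, ← gridObs_last h δ (N + 1) ω, ← init_gridObs h δ N ω]
      constructor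
      · rintro rfl
        exact ⟨rfl, rfl⟩
      · rintro ⟨h1, h2⟩
        rw [← Fin.snoc_init_self (gridObs h δ (N + 1) ω), ← Fin.snoc_init_self y, h1, h2]
    split_ifs with hy
    · have hset : {ω | gridObs h δ (N + 1) ω = y} ∩ {ω | coord ((N + 1 : ℕ) * δ) ω = i}
          = {ω | gridObs h δ N ω = Fin.init y} ∩ {ω | coord (N * δ + δ) ω = i} := by
        ext ω
        rw [hN]
        simp only [Set.mem_inter_iff, Set.mem_ofPred_eq, hsplit, and_congr_left_iff,
          and_iff_left_iff_imp]
        rintro rfl _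
        exact hy
      have hmeas := measurableSet_gridObs_eq h δ N (Fin.init y)
      have hmeas' : MeasurableSet ({ω | gridObs h δ N ω = Fin.init y} ∩
          {ω | coord (N * δ + δ) ω = i}) :=
        (natFilt_le _ _ hmeas).inter (measurableSet_coord _ {i})
      rw [hset, one_mul, measureReal_eq_sum_coord hmeas' (N * δ)]
      refine Finset.sum_congr rfl fun j _ => ?_
      rw [← ih, Set.inter_right_comm]
      exact hP.measureReal_inter δ
        (MeasurableSet.inter hmeas (measurableSet_natFilt_coord le_rfl {j})) (fun ω hω => hω.2) i
    · rw [zero_mul]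
      convert measureReal_empty
      ext ω
      rw [hN]
      simp only [Set.mem_inter_iff, Set.mem_ofPred_eq, hsplit, Set.mem_empty_iff_false, iff_false,
        not_and]
      rintro ⟨_, h2⟩ rfl
      exact hy h2

lemma IsMarkovLaw.measureReal_gridObs (hP : IsMarkovLaw Λ μ P) (hμ : μ ∈ stdSimplex ℝ I)
    (h : I → O) (δ : ℝ≥0) (N : ℕ) (y : Fin (N + 1) → O) :
    P.real {ω | gridObs h δ N ω = y}
      = ∑ i, (μ ᵥ* gridProd (NormedSpace.exp ((δ : ℝ) • Λ)) h N y) i := by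
  have := hP.prob
  rw [measureReal_eq_sum_coord (natFilt_le _ _ (measurableSet_gridObs_eq h δ N y)) (N * δ)]
  exact Finset.sum_congr rfl fun i _ => hP.measureReal_gridObs_coord hμ h δ N y i

end Law

/-! ### Two jumps in a short time interval -/

section TwoJumps

variable {I : Type*}

lemma exists_ne_succ {α : Type*} {Z : ℕ → α} {a b : ℕ} (hab : a ≤ b) (hne : Z a ≠ Z b) :
    ∃ j, a ≤ j ∧ j < b ∧ Z j ≠ Z (j + 1) := by
  by_contra! hcon
  refine hne ?_
  clear hne
  induction b, hab using Nat.le_induction with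
  | base => rfl
  | succ b hab ih =>
    exact (ih fun j h1 h2 => hcon j h1 (by omega)).trans (hcon b hab (by omega))

/-- By right continuity, the value at `p` is seen at the first point after `p` of all sufficiently
fine grids. -/
lemma eventually_coord_ceil_eq (ω : PathSpace I) {s δ p : ℝ≥0} (hδ : 0 < δ) (hp : s ≤ p) :
    ∀ᶠ M : ℕ in atTop, coord (s + ⌈(p - s) * M / δ⌉₊ * (δ / M)) ω = coord p ω := by
  have hlim : Tendsto (fun M : ℕ => s + ⌈(p - s) * M / δ⌉₊ * (δ / M)) atTop (𝓝[≥] p) := by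
    have hlow : ∀ᶠ M : ℕ in atTop, p ≤ s + ⌈(p - s) * M / δ⌉₊ * (δ / M) := by
      filter_upwards [eventually_gt_atTop 0] with M hM
      have hM' : (0 : ℝ≥0) < M := by exact_mod_cast hM
      have h1 : (p - s) * M / δ ≤ ⌈(p - s) * M / δ⌉₊ := Nat.le_ceil _
      calc p = s + (p - s) * M / δ * (δ / M) := by
            rw [div_mul_div_comm, mul_comm δ, mul_div_mul_right _ _ hδ.ne',
              mul_div_cancel_right₀ _ hM'.ne', add_tsub_cancel_of_le hp]
        _ ≤ _ := by gcongr
    have hupp : ∀ᶠ M : ℕ in atTop, s + ⌈(p - s) * M / δ⌉₊ * (δ / M) ≤ p + δ / M := by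
      filter_upwards [eventually_gt_atTop 0] with M hM
      have hM' : (0 : ℝ≥0) < M := by exact_mod_cast hM
      have h1 : (⌈(p - s) * M / δ⌉₊ : ℝ≥0) ≤ (p - s) * M / δ + 1 :=
        (Nat.ceil_lt_add_one zero_le).le
      calc s + ⌈(p - s) * M / δ⌉₊ * (δ / M) ≤ s + ((p - s) * M / δ + 1) * (δ / M) := by gcongr
        _ = p + δ / M := by
            rw [add_mul, one_mul, div_mul_div_comm, mul_comm δ, mul_div_mul_right _ _ hδ.ne',
              mul_div_cancel_right₀ _ hM'.ne', ← add_assoc, add_tsub_cancel_of_le hp]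
    refine tendsto_nhdsWithin_iff.2 ⟨?_, hlow⟩
    refine tendsto_of_tendsto_of_tendsto_of_le_of_le' tendsto_const_nhds ?_ hlow hupp
    have : Tendsto (fun M : ℕ => p + δ / (M : ℝ≥0)) atTop (𝓝 (p + 0)) :=
      tendsto_const_nhds.add (tendsto_const_div_atTop_nhds_zero_nat δ)
    rwa [add_zero] at this
  exact hlim.eventually (ω.2.1 p)

/-- On the grid of mesh `δ / M` in `[s, s + δ]` the path changes in two different cells. -/
def twoGridJumps (I : Type*) (s δ : ℝ≥0) (M : ℕ) : Set (PathSpace I) :=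
  ⋃ j ∈ Finset.range M, ⋃ l ∈ Finset.range j,
    {ω | coord (s + l * (δ / M)) ω ≠ coord (s + l * (δ / M) + δ / M) ω} ∩
    {ω | coord (s + j * (δ / M)) ω ≠ coord (s + j * (δ / M) + δ / M) ω}

lemma eventually_mem_twoGridJumps {ω : PathSpace I} {s δ : ℝ≥0}
    (hω : ¬ AtMostOneJump ω s (s + δ)) : ∀ᶠ M : ℕ in atTop, ω ∈ twoGridJumps I s δ M := by
  rw [AtMostOneJump] at hω
  push Not at hω
  obtain ⟨u, v, w, hu, huv, hvw, hw, h1, h2⟩ := hω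
  have hδ : 0 < δ := by
    rcases eq_or_lt_of_le (zero_le (a := δ)) with h0 | h0
    · rw [← h0, add_zero] at hw
      exact absurd (congrArg (coord · ω) (le_antisymm huv (hvw.trans (hw.trans hu)))) h1
    · exact h0
  filter_upwards [eventually_coord_ceil_eq ω hδ hu, eventually_coord_ceil_eq ω hδ (hu.trans huv),
    eventually_coord_ceil_eq ω hδ (hu.trans (huv.trans hvw)), eventually_gt_atTop 0]
    with M hMu hMv hMw hM
  have hM' : (0 : ℝ≥0) < M := by exact_mod_cast hM
  set Z : ℕ → I := fun k => coord (s + k * (δ / M)) ω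
  have hk1 : ⌈(u - s) * M / δ⌉₊ ≤ ⌈(v - s) * M / δ⌉₊ := by gcongr
  have hk2 : ⌈(v - s) * M / δ⌉₊ ≤ ⌈(w - s) * M / δ⌉₊ := by gcongr
  have hk3 : ⌈(w - s) * M / δ⌉₊ ≤ M := by
    rw [Nat.ceil_le, div_le_iff₀ hδ, mul_comm]
    gcongr
    exact tsub_le_iff_left.2 hw
  obtain ⟨l, -, hl2, hl3⟩ := exists_ne_succ (Z := Z) hk1 (by simpa only [Z, hMu, hMv] using h1)
  obtain ⟨j, hj1, hj2, hj3⟩ := exists_ne_succ (Z := Z) hk2 (by simpa only [Z, hMv, hMw] using h2)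
  have hstep : ∀ k : ℕ, s + k * (δ / M) + δ / M = s + (k + 1 : ℕ) * (δ / M) := fun k => by
    push_cast
    ring
  simp only [twoGridJumps, Set.mem_iUnion, Finset.mem_range, exists_prop, hstep]
  exact ⟨j, by omega, l, by omega, hl3, hj3⟩

variable [Fintype I] [DecidableEq I] {Λ : Matrix I I ℝ} {μ : I → ℝ} {P : Measure (PathSpace I)}

lemma IsMarkovLaw.measure_twoGridJumps_le (hP : IsMarkovLaw Λ μ P) {B δ₀ : ℝ} (hB : 0 ≤ B)
    (hexp : ∀ u : ℝ≥0, (u : ℝ) ≤ δ₀ → ‖NormedSpace.exp ((u : ℝ) • Λ) - 1‖ ≤ B * u)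
    (s : ℝ≥0) {δ : ℝ≥0} (hδ : (δ : ℝ) ≤ δ₀) {M : ℕ} (hM : 0 < M) :
    P (twoGridJumps I s δ M) ≤ ENNReal.ofReal (B ^ 2 * δ ^ 2) := by
  have := hP.prob
  have hM' : (1 : ℝ) ≤ M := by exact_mod_cast hM
  set η : ℝ≥0 := δ / M with hη
  have hηδ : (η : ℝ) ≤ δ₀ := by
    refine le_trans ?_ hδ
    rw [hη, NNReal.coe_div, NNReal.coe_natCast]
    exact div_le_self δ.coe_nonneg hM'
  have hJ : ∀ l j : ℕ, l < j → P.real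
      ({ω | coord (s + l * η) ω ≠ coord (s + l * η + η) ω} ∩
        {ω | coord (s + j * η) ω ≠ coord (s + j * η + η) ω}) ≤ (B * η) ^ 2 := by
    intro l j hlj
    have h0 : 0 ≤ B * η := by positivity
    have h1 : P.real {ω | coord (s + l * η) ω ≠ coord (s + l * η + η) ω} ≤ B * η := by
      have := hP.measureReal_inter_ne_le (s + l * η) η MeasurableSet.univ
      rw [Set.univ_inter, probReal_univ, one_mul] at this
      exact this.trans (hexp η hηδ)
    have hle : s + l * η + η ≤ s + j * η := by
      have : ((l + 1 : ℕ) : ℝ≥0) ≤ j := by exact_mod_cast hlj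
      calc s + l * η + η = s + (l + 1 : ℕ) * η := by push_cast; ring
        _ ≤ s + j * η := by gcongr
    have hmeas : MeasurableSet[natFilt I (s + j * η)]
        {ω : PathSpace I | coord (s + l * η) ω ≠ coord (s + l * η + η) ω} :=
      measurableSet_natFilt_coord_ne (le_self_add.trans hle) hle
    refine (hP.measureReal_inter_ne_le (s + j * η) η hmeas).trans ?_
    rw [sq]
    exact mul_le_mul h1 (hexp η hηδ) (norm_nonneg _) h0
  have hreal : P.real (twoGridJumps I s δ M) ≤ B ^ 2 * δ ^ 2 := by
    rw [twoGridJumps]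
    calc _ ≤ ∑ j ∈ Finset.range M, ∑ l ∈ Finset.range j, (B * η) ^ 2 :=
          (measureReal_biUnion_finset_le _ _).trans (Finset.sum_le_sum fun j _ =>
            (measureReal_biUnion_finset_le _ _).trans (Finset.sum_le_sum fun l hl =>
              hJ l j (Finset.mem_range.1 hl)))
      _ ≤ ∑ j ∈ Finset.range M, (M : ℝ) * (B * η) ^ 2 := by
          refine Finset.sum_le_sum fun j hj => ?_
          rw [Finset.sum_const, Finset.card_range, nsmul_eq_mul]
          have : (j : ℝ) ≤ M := by exact_mod_cast (Finset.mem_range.1 hj).le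
          gcongr
      _ = B ^ 2 * δ ^ 2 := by
          rw [Finset.sum_const, Finset.card_range, nsmul_eq_mul, hη, NNReal.coe_div,
            NNReal.coe_natCast]
          field_simp
  rw [← ofReal_measureReal]
  exact ENNReal.ofReal_le_ofReal hreal

lemma IsMarkovLaw.measure_not_atMostOneJump_le (hP : IsMarkovLaw Λ μ P) {B δ₀ : ℝ} (hB : 0 ≤ B)
    (hexp : ∀ u : ℝ≥0, (u : ℝ) ≤ δ₀ → ‖NormedSpace.exp ((u : ℝ) • Λ) - 1‖ ≤ B * u)
    (s : ℝ≥0) {δ : ℝ≥0} (hδ : (δ : ℝ) ≤ δ₀) :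
    P {ω | ¬ AtMostOneJump ω s (s + δ)} ≤ ENNReal.ofReal (B ^ 2 * δ ^ 2) := by
  have hsub : {ω : PathSpace I | ¬ AtMostOneJump ω s (s + δ)}
      ⊆ ⋃ n : ℕ, ⋂ M ≥ n + 1, twoGridJumps I s δ M := by
    intro ω hω
    obtain ⟨n, hn⟩ := eventually_atTop.1 (eventually_mem_twoGridJumps hω)
    simp only [Set.mem_iUnion, Set.mem_iInter]
    exact ⟨n, fun M hM => hn M (by omega)⟩
  have hmono : Monotone fun n : ℕ => ⋂ M ≥ n + 1, twoGridJumps I s δ M := by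
    intro n m hnm
    exact Set.iInter₂_mono' fun M hM => ⟨M, by omega, subset_rfl⟩
  refine (measure_mono hsub).trans ?_
  rw [hmono.measure_iUnion]
  refine iSup_le fun n => (measure_mono (Set.iInter₂_subset (n + 1) le_rfl)).trans ?_
  exact hP.measure_twoGridJumps_le hB hexp s hδ (Nat.succ_pos n)

end TwoJumps

/-! ### Convergence of the grid filter, uniformly in the initial distribution -/

section Convergence

variable {I O : Type*} [Fintype I] [DecidableEq I] [Fintype O] [DecidableEq O]
  {Λ : Matrix I I ℝ} {h : I → O} {κ : O → I → ℝ}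

/-- The conditional law of `X_{Nδ}` given that the observations on the grid are `y`. When the
pattern `y` has probability zero the value is `0`. -/
noncomputable def gridFilter (Λ : Matrix I I ℝ) (h : I → O) (μ : I → ℝ) (δ : ℝ≥0) (N : ℕ)
    (y : Fin (N + 1) → O) : I → ℝ :=
  (∑ j, (μ ᵥ* gridProd (NormedSpace.exp ((δ : ℝ) • Λ)) h N y) j)⁻¹ •
    (μ ᵥ* gridProd (NormedSpace.exp ((δ : ℝ) • Λ)) h N y)

omit [Fintype I] [DecidableEq I] [DecidableEq O] in
lemma measurable_comp_gridObs {β : Type*} [MeasurableSpace β] (h : I → O) (δ : ℝ≥0) (N : ℕ)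
    (g : (Fin (N + 1) → O) → β) : Measurable fun ω => g (gridObs h δ N ω) := by
  intro A _
  have : (fun ω => g (gridObs h δ N ω)) ⁻¹' A = ⋃ y ∈ g ⁻¹' A, {ω | gridObs h δ N ω = y} := by
    ext ω
    simp
  rw [this]
  exact MeasurableSet.biUnion (Set.to_countable _) fun y _ =>
    natFilt_le _ _ (measurableSet_gridObs_eq h δ N y)

omit [Fintype I] [DecidableEq I] in
lemma integral_comp_gridObs {P : Measure (PathSpace I)} [IsProbabilityMeasure P] (h : I → O)
    (δ : ℝ≥0) (N : ℕ) (g : (Fin (N + 1) → O) → ℝ) :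
    ∫ ω, g (gridObs h δ N ω) ∂P = ∑ y, P.real {ω | gridObs h δ N ω = y} * g y := by
  have hm : ∀ y, MeasurableSet {ω : PathSpace I | gridObs h δ N ω = y} := fun y =>
    natFilt_le _ _ (measurableSet_gridObs_eq h δ N y)
  have hsum : (fun ω => g (gridObs h δ N ω))
      = fun ω => ∑ y, Set.indicator {ω | gridObs h δ N ω = y} (fun _ => g y) ω := by
    ext ω
    simp [Set.indicator_apply]
  rw [hsum, integral_finsetSum _ fun y _ => (integrable_const (g y)).indicator (hm y)]
  exact Finset.sum_congr rfl fun y _ => by rw [integral_indicator_const _ (hm y), smul_eq_mul]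

omit [Fintype O] in
lemma gridFilter_mem_closedBall (hΛ : IsRateMatrix Λ) {μ : I → ℝ} (hμ : μ ∈ stdSimplex ℝ I)
    (h : I → O) (δ : ℝ≥0) (N : ℕ) (y : Fin (N + 1) → O) :
    gridFilter Λ h μ δ N y ∈ Metric.closedBall (0 : I → ℝ) 1 := by
  have hnn : ∀ j, 0 ≤ (μ ᵥ* gridProd (NormedSpace.exp ((δ : ℝ) • Λ)) h N y) j := by
    have hlev : ∀ a i j, 0 ≤ levelProj h a i j := fun a i j => by
      rw [levelProj, Matrix.diagonal_apply]
      split_ifs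
      · simp only [levelInd]; split_ifs <;> norm_num
      · exact le_rfl
    have hprod : ∀ (N : ℕ) (y : Fin (N + 1) → O) (i j : I),
        0 ≤ gridProd (NormedSpace.exp ((δ : ℝ) • Λ)) h N y i j := by
      intro N
      induction N with
      | zero => exact fun y => hlev _
      | succ N ih =>
        intro y i j
        rw [gridProd, Matrix.mul_apply]
        refine Finset.sum_nonneg fun k _ => mul_nonneg ?_ (hlev _ _ _)
        rw [Matrix.mul_apply]
        exact Finset.sum_nonneg fun l _ => mul_nonneg (ih _ _ _)
          (exp_nonneg_of_offDiag_nonneg hΛ.nonneg δ.coe_nonneg _ _)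
    exact fun j => Finset.sum_nonneg fun i _ => mul_nonneg (hμ.1 i) (hprod N y i j)
  rw [mem_closedBall_zero_iff, pi_norm_le_iff_of_nonneg zero_le_one]
  intro j
  have hs := Finset.sum_nonneg fun j (_ : j ∈ Finset.univ) => hnn j
  rw [gridFilter, Pi.smul_apply, smul_eq_mul, Real.norm_of_nonneg
    (mul_nonneg (inv_nonneg.2 hs) (hnn j)), mul_comm, ← div_eq_mul_inv]
  exact div_le_one_of_le₀ (Finset.single_le_sum
    (f := fun j => (μ ᵥ* gridProd (NormedSpace.exp ((δ : ℝ) • Λ)) h N y) j)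
    (fun j _ => hnn j) (Finset.mem_univ j)) hs

/-- The filter and its grid approximation differ by at least `ε` with a probability that is
bounded uniformly in the initial distribution. On the event that the pattern `y` is observed and
no cell contains two jumps the distance is at most `2 e(y) / p(y)`, where `p(y)` is the probability
of the pattern; so Markov's inequality leaves the sum of the errors `e(y)`. -/
lemma measure_le_dist_gridFilter_le (hΛ : IsRateMatrix Λ) (hκ : ∀ a, κ a ∈ face h a) :
    ∃ B > 0, ∃ δ₀ > 0, ∀ δ : ℝ≥0, (δ : ℝ) ≤ δ₀ → ∀ (N : ℕ) (ε : ℝ), 0 < ε →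
      ∀ (μ : I → ℝ) (P : Measure (PathSpace I)), μ ∈ stdSimplex ℝ I → IsMarkovLaw Λ μ P →
      P {ω | ε ≤ dist (filterProc Λ h κ μ (N * δ) ω) (gridFilter Λ h μ δ N (gridObs h δ N ω))}
        ≤ ENNReal.ofReal (N * (B ^ 2 * δ ^ 2) + 2 / ε * (Fintype.card O * N *
          (Fintype.card O * (B * δ ^ 2)) * (1 + Fintype.card O * (B * δ)) ^ N)) := by
  obtain ⟨B, hB, δ₀, hδ₀, hcell⟩ := exists_cell_matrix Λ hΛ (O := O)
  refine ⟨B, hB, δ₀, hδ₀, fun δ hδ N ε hε μ P hμ hP => ?_⟩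
  have := hP.prob
  obtain ⟨hQ, -, hS⟩ := hcell h κ μ hκ hμ δ hδ
  have hexp : ∀ u : ℝ≥0, (u : ℝ) ≤ δ₀ → ‖NormedSpace.exp ((u : ℝ) • Λ) - 1‖ ≤ B * u :=
    fun u hu => (hcell h κ μ hκ hμ u hu).2.1
  have hb : 0 ≤ B * (δ : ℝ) := by positivity
  have hq : 0 ≤ B * (δ : ℝ) ^ 2 := by positivity
  set p : (Fin (N + 1) → O) → ℝ := fun y =>
    ∑ j, (μ ᵥ* gridProd (NormedSpace.exp ((δ : ℝ) • Λ)) h N y) j with hp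
  have hpP : ∀ y, P.real {ω | gridObs h δ N ω = y} = p y := hP.measureReal_gridObs hμ h δ N
  set e : (Fin (N + 1) → O) → ℝ := gridErr (B * δ) (B * δ ^ 2) N
  set T := Finset.univ.filter fun y => ε * p y ≤ 2 * e y with hT
  have hsub : {ω | ε ≤ dist (filterProc Λ h κ μ (N * δ) ω)
      (gridFilter Λ h μ δ N (gridObs h δ N ω))} ⊆
      (⋃ k ∈ Finset.range N, {ω | ¬ AtMostOneJump ω (k * δ) (k * δ + δ)}) ∪
      ⋃ y ∈ T, {ω | gridObs h δ N ω = y} := by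
    intro ω hω
    by_cases hgood : ∀ k < N, AtMostOneJump ω (k * δ) (k * δ + δ)
    · right
      simp only [Set.mem_iUnion, Set.mem_ofPred_eq, exists_prop, exists_eq_right', hT,
        Finset.mem_filter, Finset.mem_univ, true_and]
      set y := gridObs h δ N ω
      rcases eq_or_lt_of_le (hpP y ▸ measureReal_nonneg : 0 ≤ p y) with h0 | h0
      · rw [← h0, mul_zero]
        exact mul_nonneg two_pos.le (gridErr_nonneg hb hq N y)
      · obtain ⟨W, ⟨c, -, hW⟩, -, hWe⟩ := exists_grid_matrix hΛ hκ hμ hb hq hQ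
          (fun s hs => hS s ω hs) N hgood
        have hdist := dist_normalize_le (c := c) (filterProc_mem_face hΛ hκ hμ (N * δ) ω).1 h0
          (e := e y) (by
            refine le_trans (le_of_eq ?_) ((sum_abs_vecMul_le hμ _).trans hWe)
            rw [Matrix.vecMul_sub, hW]
            simp only [Pi.sub_apply, Pi.smul_apply, smul_eq_mul, y])
        have := le_trans (hω : ε ≤ _) hdist
        rwa [le_div_iff₀ h0] at this
    · left
      push Not at hgood
      obtain ⟨k, hk, hkω⟩ := hgood
      simp only [Set.mem_iUnion, Set.mem_ofPred_eq, exists_prop]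
      exact ⟨k, Finset.mem_range.2 hk, hkω⟩
  have h1 : P (⋃ k ∈ Finset.range N, {ω | ¬ AtMostOneJump ω (k * δ) (k * δ + δ)})
      ≤ ENNReal.ofReal (N * (B ^ 2 * δ ^ 2)) := by
    refine (measure_biUnion_finset_le _ _).trans ((Finset.sum_le_sum fun k _ =>
      hP.measure_not_atMostOneJump_le hB.le hexp ((k : ℕ) * δ) hδ).trans ?_)
    rw [Finset.sum_const, Finset.card_range, nsmul_eq_mul, ENNReal.ofReal_mul (Nat.cast_nonneg _),
      ENNReal.ofReal_natCast]
  have h2 : P (⋃ y ∈ T, {ω | gridObs h δ N ω = y})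
      ≤ ENNReal.ofReal (2 / ε * (Fintype.card O * N *
          (Fintype.card O * (B * δ ^ 2)) * (1 + Fintype.card O * (B * δ)) ^ N)) := by
    rw [← ofReal_measureReal (measure_ne_top P _)]
    refine ENNReal.ofReal_le_ofReal ?_
    calc P.real (⋃ y ∈ T, {ω | gridObs h δ N ω = y})
        ≤ ∑ y ∈ T, p y := (measureReal_biUnion_finset_le _ _).trans
          (Finset.sum_le_sum fun y _ => (hpP y).le)
      _ ≤ ∑ y ∈ T, 2 / ε * e y := Finset.sum_le_sum fun y hy => by
          have := (Finset.mem_filter.1 hy).2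
          rw [div_mul_eq_mul_div, le_div_iff₀ hε]
          linarith
      _ ≤ ∑ y, 2 / ε * e y := Finset.sum_le_univ_sum_of_nonneg fun y =>
          mul_nonneg (by positivity) (gridErr_nonneg hb hq N y)
      _ ≤ _ := by
          rw [← Finset.mul_sum]
          exact mul_le_mul_of_nonneg_left (sum_gridErr_le hb hq N) (by positivity)
  refine (measure_mono hsub).trans ((measure_union_le _ _).trans ((add_le_add h1 h2).trans ?_))
  rw [← ENNReal.ofReal_add (by positivity) (by positivity)]

lemma exists_measure_le_dist_gridFilter_le (hΛ : IsRateMatrix Λ) (hκ : ∀ a, κ a ∈ face h a)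
    (t : ℝ≥0) {ε : ℝ} (hε : 0 < ε) :
    ∃ K : ℝ, ∀ᶠ N : ℕ in atTop,
      ∀ (μ : I → ℝ) (P : Measure (PathSpace I)), μ ∈ stdSimplex ℝ I → IsMarkovLaw Λ μ P →
      P {ω | ε ≤ dist (filterProc Λ h κ μ t ω) (gridFilter Λ h μ (t / N) N
        (gridObs h (t / N) N ω))} ≤ ENNReal.ofReal (K / N) := by
  obtain ⟨B, hB, δ₀, hδ₀, hmain⟩ := measure_le_dist_gridFilter_le hΛ hκ
  set n := (Fintype.card O : ℝ)
  have hsmall : ∀ᶠ N : ℕ in atTop, (t : ℝ) / N ≤ δ₀ :=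
    (tendsto_const_div_atTop_nhds_zero_nat (t : ℝ)).eventually_le_const hδ₀
  refine ⟨B ^ 2 * t ^ 2 + 2 / ε * (n * (n * (B * t ^ 2)) * Real.exp (n * (B * t))), ?_⟩
  filter_upwards [hsmall, eventually_gt_atTop 0] with N hN hN0 μ P hμ hP
  have hN' : (0 : ℝ) < N := by exact_mod_cast hN0
  have hcast : ((t / N : ℝ≥0) : ℝ) = t / N := by push_cast; rfl
  have hle := hmain (t / N) (by rw [hcast]; exact hN) N ε hε μ P hμ hP
  rw [mul_div_cancel₀ t (by exact_mod_cast hN0.ne' : (N : ℝ≥0) ≠ 0), hcast] at hle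
  refine hle.trans (ENNReal.ofReal_le_ofReal ?_)
  have hpow : (1 + n * (B * (t / N))) ^ N ≤ Real.exp (n * (B * t)) := by
    calc (1 + n * (B * (t / N))) ^ N ≤ Real.exp (n * (B * (t / N))) ^ N := by
          gcongr
          linarith [Real.add_one_le_exp (n * (B * ((t : ℝ) / N)))]
      _ = Real.exp (n * (B * t)) := by
          rw [← Real.exp_nat_mul]
          congr 1
          field_simp
  calc N * (B ^ 2 * ((t : ℝ) / N) ^ 2) + 2 / ε * (n * N * (n * (B * (t / N) ^ 2))
        * (1 + n * (B * (t / N))) ^ N)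
      ≤ N * (B ^ 2 * ((t : ℝ) / N) ^ 2) + 2 / ε * (n * N * (n * (B * (t / N) ^ 2))
        * Real.exp (n * (B * t))) := by gcongr
    _ = (B ^ 2 * t ^ 2 + 2 / ε * (n * (n * (B * t ^ 2)) * Real.exp (n * (B * t)))) / N := by
        field_simp

lemma aemeasurable_filterProc (hΛ : IsRateMatrix Λ) (hκ : ∀ a, κ a ∈ face h a) (t : ℝ≥0)
    {μ : I → ℝ} {P : Measure (PathSpace I)} (hμ : μ ∈ stdSimplex ℝ I) (hP : IsMarkovLaw Λ μ P) :
    AEMeasurable (filterProc Λ h κ μ t) P := by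
  refine TendstoInMeasure.aemeasurable (u := atTop)
    (f := fun N : ℕ => fun ω => gridFilter Λ h μ (t / N) N (gridObs h (t / N) N ω))
    (fun N => (measurable_comp_gridObs h _ N _).aemeasurable) ?_
  rw [tendstoInMeasure_iff_dist]
  intro ε hε
  obtain ⟨K, hK⟩ := exists_measure_le_dist_gridFilter_le hΛ hκ t hε
  have hlim : Tendsto (fun N : ℕ => ENNReal.ofReal (K / N)) atTop (𝓝 0) := by
    have := ENNReal.tendsto_ofReal (tendsto_const_div_atTop_nhds_zero_nat K)
    rwa [ENNReal.ofReal_zero] at this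
  refine tendsto_of_tendsto_of_tendsto_of_le_of_le' tendsto_const_nhds hlim
    (Eventually.of_forall fun _ => zero_le) (hK.mono fun N hN => ?_)
  simpa only [dist_comm] using hN μ P hμ hP

omit [Fintype O] in
/-- For short times the filter stays close to the initial distribution, with a probability that is
close to `1` uniformly in the initial distribution: most likely the chain does not move. -/
lemma measure_lt_dist_filterProc_le (hΛ : IsRateMatrix Λ) (hκ : ∀ a, κ a ∈ face h a) :
    ∃ B > 0, ∃ δ₀ > 0, ∀ t : ℝ≥0, (t : ℝ) ≤ δ₀ →
      ∀ (ν : I → ℝ) (P : Measure (PathSpace I)), ν ∈ effSimplex h → IsMarkovLaw Λ ν P →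
      P {ω | 2 * (B * t ^ 2 + B * t) < dist (filterProc Λ h κ ν t ω) ν}
        ≤ ENNReal.ofReal (B ^ 2 * t ^ 2 + B * t) := by
  obtain ⟨B, hB, δ₀, hδ₀, hcell⟩ := exists_cell_matrix Λ hΛ (O := O)
  refine ⟨B, hB, δ₀, hδ₀, fun t ht ν P hν hP => ?_⟩
  have := hP.prob
  obtain ⟨a, ha⟩ := Set.mem_iUnion.1 hν
  obtain ⟨-, hQ, hS⟩ := hcell h κ ν hκ ha.1 t ht
  have hexp : ∀ u : ℝ≥0, (u : ℝ) ≤ δ₀ → ‖NormedSpace.exp ((u : ℝ) • Λ) - 1‖ ≤ B * u :=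
    fun u hu => (hcell h κ ν hκ ha.1 u hu).2.1
  have hnull : P {ω | obs h ω 0 ≠ a} = 0 := by
    have : {ω : PathSpace I | obs h ω 0 ≠ a} = ⋃ i ∈ {i | h i ≠ a}, {ω | coord 0 ω = i} := by
      ext ω
      simp [obs]
    rw [this, measure_biUnion_null_iff (Set.to_countable _)]
    intro i hi
    rw [hP.init, ha.2 i hi, ENNReal.ofReal_zero]
  have hsub : {ω | 2 * (B * (t : ℝ) ^ 2 + B * t) < dist (filterProc Λ h κ ν t ω) ν} ⊆
      {ω | obs h ω 0 ≠ a} ∪ ({ω | ¬ AtMostOneJump ω 0 (0 + t)} ∪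
        {ω | coord 0 ω ≠ coord (0 + t) ω}) := by
    intro ω hω
    by_contra hcon
    simp only [Set.mem_union, Set.mem_ofPred_eq, not_or, not_not] at hcon
    obtain ⟨h0, hjump, hX⟩ := hcon
    have ht' : obs h ω (0 + t) = a := by rw [← h0, obs, obs, hX]
    obtain ⟨S, ⟨c, -, hSc⟩, -, hSn⟩ := hS 0 ω hjump
    obtain ⟨d, -, hd⟩ := exists_vecMul_levelProj_eq_filterProc_zero (h := h) hΛ hκ ha.1 ω
    have hface := filterProc_mem_face hΛ hκ ha.1 (0 + t) ω
    rw [h0, ht'] at hSn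
    rw [h0, vecMul_levelProj_of_mem_face ha] at hd
    rw [ht'] at hface
    set D := levelProj h a
    have hn : ‖D * S * D - D * 1 * D‖ ≤ B * t ^ 2 + B * t := by
      have : D * S * D - D * 1 * D = (D * S * D - D * NormedSpace.exp ((t : ℝ) • Λ) * D)
          + D * (NormedSpace.exp ((t : ℝ) • Λ) - 1) * D := by noncomm_ring
      rw [this]
      exact (norm_add_le _ _).trans
        (add_le_add hSn ((norm_levelProj_mul_mul_le h a a _).trans hQ))
    have hνS : ν ᵥ* (D * S * D) = (d * c) • filterProc Λ h κ ν (0 + t) ω := by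
      have hνS' : ν ᵥ* S = (d • filterProc Λ h κ ν 0 ω) ᵥ* S := congrArg (· ᵥ* S) hd
      rw [← Matrix.vecMul_vecMul, ← Matrix.vecMul_vecMul, vecMul_levelProj_of_mem_face ha, hνS',
        Matrix.smul_vecMul, hSc, Matrix.smul_vecMul, Matrix.smul_vecMul,
        vecMul_levelProj_of_mem_face hface, mul_smul]
    have hν1 : ν ᵥ* (D * 1 * D) = ν := by
      rw [mul_one, ← Matrix.vecMul_vecMul, vecMul_levelProj_of_mem_face ha,
        vecMul_levelProj_of_mem_face ha]
    have hdist := dist_normalize_le (c := d * c) (ρ := ν) hface.1 (by rw [ha.1.2]; exact one_pos)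
      (e := B * t ^ 2 + B * t) (by
        refine le_trans (le_of_eq ?_) ((sum_abs_vecMul_le ha.1 _).trans hn)
        rw [Matrix.vecMul_sub, hνS, hν1]
        simp only [Pi.sub_apply, Pi.smul_apply, smul_eq_mul])
    rw [ha.1.2, inv_one, one_smul, div_one, zero_add] at hdist
    exact absurd (hω : _ < _) (not_lt.2 hdist)
  have h2 : P {ω | coord 0 ω ≠ coord (0 + t) ω} ≤ ENNReal.ofReal (B * t) := by
    rw [← ofReal_measureReal]
    refine ENNReal.ofReal_le_ofReal ?_
    have := hP.measureReal_inter_ne_le 0 t MeasurableSet.univ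
    rw [Set.univ_inter, probReal_univ, one_mul] at this
    exact this.trans hQ
  refine (measure_mono hsub).trans ((measure_union_le _ _).trans ?_)
  rw [hnull, zero_add, ENNReal.ofReal_add (by positivity) (by positivity)]
  exact (measure_union_le _ _).trans
    (add_le_add (hP.measure_not_atMostOneJump_le hB.le hexp 0 ht) h2)

end Convergence

/-! ### Passage to expectations -/

section Expectations

variable {I O : Type*} [Fintype I]

/-- Closeness in probability gives closeness of expectations of a continuous bounded function, at a
rate that depends on the random variables only through the probability of being apart. -/
lemma exists_abs_integral_sub_le (F : BoundedContinuousFunction (I → ℝ) ℝ) {ε : ℝ} (hε : 0 < ε) :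
    ∃ η > 0, ∀ {Ω : Type*} [MeasurableSpace Ω] (P : Measure Ω) [IsProbabilityMeasure P]
      (Z W : Ω → I → ℝ), AEMeasurable Z P → AEMeasurable W P →
      (∀ ω, Z ω ∈ Metric.closedBall 0 1) → (∀ ω, W ω ∈ Metric.closedBall 0 1) →
      |∫ ω, F (Z ω) ∂P - ∫ ω, F (W ω) ∂P| ≤ ε + 2 * ‖F‖ * P.real {ω | η ≤ dist (Z ω) (W ω)} := by
  have huc := (isCompact_closedBall (0 : I → ℝ) 1).uniformContinuousOn_of_continuous
    F.continuous.continuousOn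
  obtain ⟨η, hη, hF⟩ := Metric.uniformContinuousOn_iff.1 huc ε hε
  refine ⟨η, hη, fun P _ Z W hZ hW hZ1 hW1 => ?_⟩
  have hint : ∀ V, AEMeasurable V P → Integrable (fun ω => F (V ω)) P := fun V hV =>
    Integrable.of_bound (F.continuous.measurable.comp_aemeasurable hV).aestronglyMeasurable ‖F‖
      (Eventually.of_forall fun ω => F.norm_coe_le_norm _)
  have hS : NullMeasurableSet {ω | η ≤ dist (Z ω) (W ω)} P :=
    nullMeasurableSet_le aemeasurable_const (hZ.dist hW)
  rw [← integral_sub (hint Z hZ) (hint W hW)]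
  refine (abs_integral_le_integral_abs).trans ?_
  have hrhs : Integrable (fun ω => ε + Set.indicator {ω | η ≤ dist (Z ω) (W ω)}
      (fun _ => 2 * ‖F‖) ω) P :=
    (integrable_const ε).add ((integrable_const _).indicator₀ hS)
  refine (integral_mono ((hint Z hZ).sub (hint W hW)).abs hrhs fun ω => ?_).trans (le_of_eq ?_)
  · by_cases hω : η ≤ dist (Z ω) (W ω)
    · rw [Set.indicator_of_mem (by exact hω)]
      have h1 := F.norm_coe_le_norm (Z ω)
      have h2 := F.norm_coe_le_norm (W ω)
      have h3 := norm_sub_le (F (Z ω)) (F (W ω))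
      rw [Real.norm_eq_abs (_ - _)] at h3
      simp only [Pi.sub_apply]
      linarith
    · rw [Set.indicator_of_notMem (by exact hω), add_zero]
      exact (hF _ (hZ1 ω) _ (hW1 ω) (not_le.1 hω)).le
  · rw [integral_add (integrable_const ε) ((integrable_const _).indicator₀ hS), integral_const,
      integral_indicator₀ hS, setIntegral_const]
    simp [mul_comm]

lemma continuous_sum_mul_normalize (F : BoundedContinuousFunction (I → ℝ) ℝ) :
    Continuous fun ρ : I → ℝ => (∑ j, ρ j) * F ((∑ j, ρ j)⁻¹ • ρ) := by
  have hs : Continuous fun ρ : I → ℝ => ∑ j, ρ j := by fun_prop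
  rw [continuous_iff_continuousAt]
  intro ρ
  by_cases h0 : ∑ j, ρ j = 0
  · -- at mass zero the normalization is discontinuous, but the factor in front tends to zero
    rw [ContinuousAt, h0, zero_mul]
    refine squeeze_zero_norm (a := fun ρ : I → ℝ => |∑ j, ρ j| * ‖F‖) (fun σ => ?_) ?_
    · rw [norm_mul, Real.norm_eq_abs]
      exact mul_le_mul_of_nonneg_left (F.norm_coe_le_norm _) (abs_nonneg _)
    · have : Tendsto (fun ρ : I → ℝ => |∑ j, ρ j| * ‖F‖) (𝓝 ρ) (𝓝 (|∑ j, ρ j| * ‖F‖)) :=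
        (hs.abs.mul continuous_const).tendsto ρ
      rwa [h0, abs_zero, zero_mul] at this
  · exact hs.continuousAt.mul (F.continuous.continuousAt.comp
      ((hs.continuousAt.inv₀ h0).smul continuousAt_id))

lemma isClosed_face (h : I → O) (a : O) : IsClosed (face h a) := by
  have : face h a = stdSimplex ℝ I ∩ ⋂ i, ⋂ _ : h i ≠ a, {x : I → ℝ | x i = 0} := by
    ext x
    simp [face]
  rw [this]
  exact (isClosed_stdSimplex ℝ I).inter (isClosed_iInter fun i => isClosed_iInter fun _ =>
    isClosed_eq (continuous_apply i) continuous_const)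

lemma effSimplex_subset_stdSimplex (h : I → O) : effSimplex h ⊆ stdSimplex ℝ I :=
  Set.iUnion_subset fun _ _ hx => hx.1

lemma isCompact_effSimplex [Finite O] (h : I → O) : IsCompact (effSimplex h) :=
  (isCompact_stdSimplex ℝ I).of_isClosed_subset (isClosed_iUnion_of_finite (isClosed_face h))
    (effSimplex_subset_stdSimplex h)

lemma mem_closedBall_of_mem_stdSimplex {x : I → ℝ} (hx : x ∈ stdSimplex ℝ I) :
    x ∈ Metric.closedBall (0 : I → ℝ) 1 := by
  rw [mem_closedBall_zero_iff, pi_norm_le_iff_of_nonneg zero_le_one]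
  intro i
  rw [Real.norm_of_nonneg (hx.1 i), ← hx.2]
  exact Finset.single_le_sum (f := x) (fun j _ => hx.1 j) (Finset.mem_univ i)

variable [DecidableEq I] [Fintype O] [DecidableEq O] {Λ : Matrix I I ℝ} {h : I → O}
  {κ : O → I → ℝ} {P : (I → ℝ) → Measure (PathSpace I)}

omit [Fintype O] in
lemma filterProc_mem_effSimplex (hΛ : IsRateMatrix Λ) (hκ : ∀ a, κ a ∈ face h a) {μ : I → ℝ}
    (hμ : μ ∈ stdSimplex ℝ I) (t : ℝ≥0) (ω : PathSpace I) :
    filterProc Λ h κ μ t ω ∈ effSimplex h :=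
  Set.mem_iUnion.2 ⟨_, filterProc_mem_face hΛ hκ hμ t ω⟩

omit [Fintype O] in
lemma preimage_filterProc_effSimplex (hΛ : IsRateMatrix Λ) (hκ : ∀ a, κ a ∈ face h a) {μ : I → ℝ}
    (hμ : μ ∈ stdSimplex ℝ I) (t : ℝ≥0) :
    filterProc Λ h κ μ t ⁻¹' effSimplex h = Set.univ :=
  Set.eq_univ_of_forall fun ω => filterProc_mem_effSimplex hΛ hκ hμ t ω

lemma isProbabilityMeasure_transition (hΛ : IsRateMatrix Λ) (hκ : ∀ a, κ a ∈ face h a)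
    (hP : ∀ μ ∈ stdSimplex ℝ I, IsMarkovLaw Λ μ (P μ)) (t : ℝ≥0) (ν : effSimplex h) :
    IsProbabilityMeasure (transition Λ h κ P t ν) := by
  have hν := effSimplex_subset_stdSimplex h ν.2
  have := (hP ν hν).prob
  have hm : MeasurableSet (effSimplex h) := (isCompact_effSimplex h).isClosed.measurableSet
  constructor
  rw [transition, (MeasurableEmbedding.subtype_coe hm).comap_apply, Set.image_univ,
    Subtype.range_coe, Measure.map_apply_of_aemeasurable
      (aemeasurable_filterProc hΛ hκ t hν (hP ν hν)) hm,
    preimage_filterProc_effSimplex hΛ hκ hν, measure_univ]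

lemma integral_transition (hΛ : IsRateMatrix Λ) (hκ : ∀ a, κ a ∈ face h a)
    (hP : ∀ μ ∈ stdSimplex ℝ I, IsMarkovLaw Λ μ (P μ)) (t : ℝ≥0) (ν : effSimplex h)
    (F : BoundedContinuousFunction (I → ℝ) ℝ) :
    ∫ ρ : effSimplex h, F ρ ∂(transition Λ h κ P t ν)
      = ∫ ω, F (filterProc Λ h κ ν t ω) ∂(P ν) := by
  have hν := effSimplex_subset_stdSimplex h ν.2
  have hm : MeasurableSet (effSimplex h) := (isCompact_effSimplex h).isClosed.measurableSet
  have hae := aemeasurable_filterProc hΛ hκ t hν (hP ν hν)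
  rw [transition, integral_subtype_comap hm (fun x => F x), setIntegral_map hm
    F.continuous.aestronglyMeasurable hae,
    preimage_filterProc_effSimplex hΛ hκ hν, Measure.restrict_univ]

/-- The expectations of the filter are uniform limits of the expectations of the grid filter, which
are continuous in the initial distribution. -/
lemma continuous_integral_filterProc (hΛ : IsRateMatrix Λ) (hκ : ∀ a, κ a ∈ face h a)
    (hP : ∀ μ ∈ stdSimplex ℝ I, IsMarkovLaw Λ μ (P μ)) (t : ℝ≥0)
    (F : BoundedContinuousFunction (I → ℝ) ℝ) :
    Continuous fun ν : effSimplex h => ∫ ω, F (filterProc Λ h κ ν t ω) ∂(P ν) := by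
  have hcont : ∀ N : ℕ, Continuous fun ν : effSimplex h =>
      ∫ ω, F (gridFilter Λ h ν (t / N) N (gridObs h (t / N) N ω)) ∂(P ν) := by
    intro N
    have heq : (fun ν : effSimplex h =>
        ∫ ω, F (gridFilter Λ h ν (t / N) N (gridObs h (t / N) N ω)) ∂(P ν))
        = fun ν : effSimplex h => ∑ y : Fin (N + 1) → O,
          (fun ρ : I → ℝ => (∑ j, ρ j) * F ((∑ j, ρ j)⁻¹ • ρ))
            ((ν : I → ℝ) ᵥ* gridProd (NormedSpace.exp (((t / N : ℝ≥0) : ℝ) • Λ)) h N y) := by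
      ext ν
      have hν := effSimplex_subset_stdSimplex h ν.2
      have := (hP ν hν).prob
      rw [integral_comp_gridObs h (t / N) N fun y => F (gridFilter Λ h ν (t / N) N y)]
      refine Finset.sum_congr rfl fun y _ => ?_
      rw [(hP ν hν).measureReal_gridObs hν]
      rfl
    rw [heq]
    refine continuous_finsetSum _ fun y _ => (continuous_sum_mul_normalize F).comp ?_
    exact Continuous.matrix_vecMul continuous_subtype_val continuous_const
  refine TendstoUniformly.continuous (p := atTop) (F := fun (N : ℕ) (ν : effSimplex h) =>
      ∫ ω, F (gridFilter Λ h ν (t / N) N (gridObs h (t / N) N ω)) ∂(P ν)) ?_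
    (Eventually.of_forall hcont).frequently
  rw [Metric.tendstoUniformly_iff]
  intro ε hε
  obtain ⟨η, hη, hF⟩ := exists_abs_integral_sub_le F (half_pos hε)
  obtain ⟨K, hK⟩ := exists_measure_le_dist_gridFilter_le hΛ hκ t hη
  have hlim : Tendsto (fun N : ℕ => ε / 2 + 2 * ‖F‖ * max (K / N) 0) atTop
      (𝓝 (ε / 2 + 2 * ‖F‖ * max 0 0)) :=
    tendsto_const_nhds.add (tendsto_const_nhds.mul
      ((tendsto_const_div_atTop_nhds_zero_nat K).max tendsto_const_nhds))
  rw [max_self, mul_zero, add_zero] at hlim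
  filter_upwards [hK, hlim.eventually_lt_const (half_lt_self hε)] with N hN hN2 ν
  have hν := effSimplex_subset_stdSimplex h ν.2
  have := (hP ν hν).prob
  rw [Real.dist_eq]
  refine (hF (P ν) _ _ (aemeasurable_filterProc hΛ hκ t hν (hP ν hν))
    (measurable_comp_gridObs h _ N _).aemeasurable
    (fun ω => mem_closedBall_of_mem_stdSimplex (filterProc_mem_face hΛ hκ hν t ω).1)
    (fun ω => gridFilter_mem_closedBall hΛ hν h _ N _)).trans_lt (lt_of_le_of_lt ?_ hN2)
  gcongr
  have := ENNReal.toReal_mono ENNReal.ofReal_ne_top (hN ν (P ν) hν (hP ν hν))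
  rwa [ENNReal.toReal_ofReal'] at this

lemma tendstoUniformly_integral_filterProc (hΛ : IsRateMatrix Λ) (hκ : ∀ a, κ a ∈ face h a)
    (hP : ∀ μ ∈ stdSimplex ℝ I, IsMarkovLaw Λ μ (P μ)) (F : BoundedContinuousFunction (I → ℝ) ℝ) :
    TendstoUniformly (fun (t : ℝ≥0) (ν : effSimplex h) =>
      ∫ ω, F (filterProc Λ h κ ν t ω) ∂(P ν)) (fun ν => F ν) (𝓝 0) := by
  rw [Metric.tendstoUniformly_iff]
  intro ε hε
  obtain ⟨η, hη, hF⟩ := exists_abs_integral_sub_le F (half_pos hε)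
  obtain ⟨B, hB, δ₀, hδ₀, hmain⟩ := measure_lt_dist_filterProc_le hΛ hκ
  have h1 : ∀ᶠ t : ℝ≥0 in 𝓝 0, (t : ℝ) < δ₀ :=
    NNReal.continuous_coe.tendsto' 0 0 NNReal.coe_zero |>.eventually_lt_const hδ₀
  have h2 : ∀ᶠ t : ℝ≥0 in 𝓝 0, 2 * (B * (t : ℝ) ^ 2 + B * t) < η :=
    (Continuous.tendsto' (by fun_prop) _ _ (by simp)).eventually_lt_const hη
  have h3 : ∀ᶠ t : ℝ≥0 in 𝓝 0, ε / 2 + 2 * ‖F‖ * (B ^ 2 * (t : ℝ) ^ 2 + B * t) < ε :=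
    (Continuous.tendsto' (by fun_prop) _ _ (by simp)).eventually_lt_const (half_lt_self hε)
  filter_upwards [h1, h2, h3] with t ht1 ht2 ht3 ν
  have hν := effSimplex_subset_stdSimplex h ν.2
  have := (hP ν hν).prob
  have hconst : F ν = ∫ _, F ν ∂(P ν) := by simp
  rw [dist_comm, Real.dist_eq, hconst]
  refine (hF (P ν) _ (fun _ => (ν : I → ℝ)) (aemeasurable_filterProc hΛ hκ t hν (hP ν hν))
    aemeasurable_const
    (fun ω => mem_closedBall_of_mem_stdSimplex (filterProc_mem_face hΛ hκ hν t ω).1)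
    (fun _ => mem_closedBall_of_mem_stdSimplex hν)).trans_lt (lt_of_le_of_lt ?_ ht3)
  gcongr
  refine ENNReal.toReal_le_of_le_ofReal (by positivity) ((measure_mono fun ω hω => ?_).trans
    (hmain t ht1.le ν (P ν) ν.2 (hP ν hν)))
  exact ht2.trans_le hω

end Expectations

end NoiseFreeFilter

theorem proposition4 {I O : Type*} [Fintype I] [DecidableEq I] [Fintype O] [DecidableEq O]
    (Λ : Matrix I I ℝ) (hΛ : IsRateMatrix Λ)
    (h : I → O) (hh : Function.Surjective h)
    (κ : O → I → ℝ) (hκ : ∀ a, κ a ∈ face h a)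
    (P : (I → ℝ) → Measure (PathSpace I))
    (hP : ∀ μ ∈ stdSimplex ℝ I, IsMarkovLaw Λ μ (P μ)) :
    (∀ (t : ℝ≥0) (ν : effSimplex h), IsProbabilityMeasure (transition Λ h κ P t ν)) ∧
    ∀ f : C(effSimplex h, ℝ),
      (∀ t : ℝ≥0, Continuous fun ν => ∫ ρ, f ρ ∂(transition Λ h κ P t ν)) ∧
      TendstoUniformly (fun (t : ℝ≥0) ν => ∫ ρ, f ρ ∂(transition Λ h κ P t ν)) f (𝓝 0) := by
  refine ⟨isProbabilityMeasure_transition hΛ hκ hP, fun f => ?_⟩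
  have hcpt := isCompact_effSimplex h
  have : CompactSpace (effSimplex h) := isCompact_iff_compactSpace.1 hcpt
  obtain ⟨F, -, hF⟩ := BoundedContinuousFunction.exists_norm_eq_domRestrict_eq_of_closed
    (BoundedContinuousFunction.mkOfCompact f) hcpt.isClosed
  have hFf : ∀ ρ : effSimplex h, f ρ = F ρ := fun ρ => (DFunLike.congr_fun hF ρ).symm
  have hfF : (f : effSimplex h → ℝ) = fun ρ : effSimplex h => F ρ := funext hFf
  simp only [hFf, integral_transition hΛ hκ hP]
  exact ⟨fun t => continuous_integral_filterProc hΛ hκ hP t F,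
    hfF ▸ tendstoUniformly_integral_filterProc hΛ hκ hP F⟩
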